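/- **Setting.** Let $F,G\in\mathbb{R}[x_0,x_1,x_2,x_3]$ be forms of the same degree $d$, irreducible over $\mathbb{C}$, and let $R,S\subset\mathbb{E}^3_{\mathbb R}$ be the real surfaces $F(1,x_1,x_2,x_3)=0$ and $G(1,x_1,x_2,x_3)=0$. Assume that $\dim_{\mathbb R}R=\dim_{\mathbb R}S=2$ and that neither $R$ nor $S$ is a cylinder (invariant under all translations in some direction), a cone (invariant under all scalings with some centre) or a surface of revolution (invariant under all rotations about some axis). Let $\mathrm{Sim}_{R,S}$ be the set of direct similarities $\psi(x)=Ax+b$ (with $A^{\top}A=cI$, $c>0$, $\det A>0$) such that $\psi(R)=S$. Such a $\psi$ acts on the complexified plane at infinity $x_0=0$ by $[x_1:x_2:x_3]\mapsto A[x_1:x_2:x_3]$, and preserves the absolute conic $\Omega: x_1^2+x_2^2+x_3^2=0$ in it. Let $\mu:\mathbb{P}^1_{\mathbb C}\to\Omega$ be an isomorphism given by binary quadratic forms, for example $[s:t]\mapsto[2st:s^2-t^2:\mathrm{i}(s^2+t^2)]$. Write $$F(0,x_1,x_2,x_3)=(x_1^2+x_2^2+x_3^2)^{k}\,\widetilde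 F,\qquad G(0,x_1,x_2,x_3)=(x_1^2+x_2^2+x_3^2)^{l}\,\widetilde G,$$ where $x_1^2+x_2^2+x_3^2$ divides neither $\widetilde F$ nor $\widetilde G$. For binary forms $P,Q$ over $\mathbb C$ put $$\mathrm{Aut}(\mathbb{P}^1)_{P,Q}=\{\varphi\in \mathrm{Aut}(\mathbb{P}^1_{\mathbb C})=PGL_2(\mathbb C)\mid \exists \lambda\in\mathbb{C}^*:\ Q\circ\varphi=\lambda P\}.$$ **Theorem.** Suppose that $\widetilde F$ and $\widetilde G$ are not constant, and let $P=\mu^*\widetilde F$, $Q=\mu^*\widetilde G$. Then $\mathrm{Aut}(\mathbb{P}^1)_{P,Q}$ is a good candidate set for $\mathrm{Sim}_{R,S}$, in the following sense. 1. Restriction to $\Omega$, $\iota(\psi)=\mu^{-1}\circ\psi|_{\Omega}\circ\mu$, defines an injective map $\iota:\mathrm{Sim}_{R,S}\hookrightarrow\mathrm{Aut}(\mathbb{P}^1)_{P,Q}$. 2. The zero sets of $P$ and of $Q$ in $\mathbb{P}^1_{\mathbb C}$ are finite and have at least two points each, and every $\varphi\in\mathrm{Aut}(\mathbb{P}^1)_{P,Q}$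 maps the zero set of $P$ onto the zero set of $Q$. 3. If $P$ has at least three distinct zeros, then $\mathrm{Sim}_{R,S}$ and $\mathrm{Aut}(\mathbb{P}^1)_{P,Q}$ are both finite (so they have the same dimension, $0$). -/

import Mathlib

open MvPolynomial
open scoped LinearAlgebra.Projectivization MatrixGroups

noncomputable section

namespace SurfaceSim

/-- Real affine 3-space, the affine part `x₀ ≠ 0` of the real projective 3-space.
Euclidean notions enter only through the matrix condition in `similitude`. -/
abbrev E3 : Type := Fin 3 → ℝ

/-- The complex projective line. -/
abbrev P1 : Type := ℙ ℂ (Fin 2 → ℂ)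

/-- The complexified plane at infinity `x₀ = 0` of projective 3-space,
with homogeneous coordinates `[x₁ : x₂ : x₃]`. -/
abbrev PInf : Type := ℙ ℂ (Fin 3 → ℂ)

/-! ### Direct similarities -/

/-- The matrices `A` with `AᵀA = c I` for some `c > 0` and `det A > 0`. -/
def similitude : Subgroup (GL (Fin 3) ℝ) where
  carrier := {A | (∃ c : ℝ, 0 < c ∧
      (A : Matrix (Fin 3) (Fin 3) ℝ).transpose * (A : Matrix (Fin 3) (Fin 3) ℝ) = c • 1) ∧
      0 < (A : Matrix (Fin 3) (Fin 3) ℝ).det}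
  mul_mem' := by
    rintro A B ⟨⟨a, ha, hA⟩, hdA⟩ ⟨⟨b, hb, hB⟩, hdB⟩
    refine ⟨⟨a * b, mul_pos ha hb, ?_⟩, ?_⟩
    · rw [Units.val_mul, Matrix.transpose_mul, Matrix.mul_assoc,
        ← Matrix.mul_assoc _ (A : Matrix (Fin 3) (Fin 3) ℝ), hA]
      simp [hB, mul_smul]
    · rw [Units.val_mul, Matrix.det_mul]
      exact mul_pos hdA hdB
  one_mem' := ⟨⟨1, one_pos, by simp⟩, by simp⟩
  inv_mem' := by
    rintro A ⟨⟨a, ha, hA⟩, hdA⟩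
    have hAi : (A : Matrix (Fin 3) (Fin 3) ℝ) * ((A⁻¹ : GL (Fin 3) ℝ) : Matrix _ _ ℝ) = 1 := by
      rw [← Units.val_mul]; simp
    refine ⟨⟨a⁻¹, inv_pos.2 ha, ?_⟩, ?_⟩
    · have h1 : (((A⁻¹ : GL (Fin 3) ℝ) : Matrix _ _ ℝ)).transpose *
          ((A : Matrix (Fin 3) (Fin 3) ℝ).transpose * (A : Matrix (Fin 3) (Fin 3) ℝ)) *
          ((A⁻¹ : GL (Fin 3) ℝ) : Matrix _ _ ℝ) = 1 := by
        rw [← Matrix.mul_assoc, ← Matrix.transpose_mul, hAi, Matrix.transpose_one,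
          Matrix.one_mul, hAi]
      rw [hA] at h1
      simp only [Matrix.mul_smul, Matrix.mul_one, Matrix.smul_mul] at h1
      rw [← h1, smul_smul, inv_mul_cancel₀ ha.ne', one_smul]
    · have h2 := congrArg Matrix.det hAi
      rw [Matrix.det_mul, Matrix.det_one] at h2
      exact (mul_pos_iff_of_pos_left hdA).1 (by rw [h2]; exact one_pos)

/-- The matrix of the linear part of an affine transformation of 3-space. -/
def linMatrix : (E3 ≃ᵃ[ℝ] E3) →* GL (Fin 3) ℝ :=
  (Matrix.GeneralLinearGroup.toLin (n := Fin 3) (R := ℝ)).symm.toMonoidHom.comp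
    ((LinearMap.GeneralLinearGroup.generalLinearEquiv ℝ E3).symm.toMonoidHom.comp
      AffineEquiv.linearHom)

/-- The group of direct similarities of Euclidean 3-space. -/
def Sim : Subgroup (E3 ≃ᵃ[ℝ] E3) := similitude.comap linMatrix

/-- The set `Sim_{A,B}` of direct similarities `φ` with `φ(A) = B`. -/
def simSet (A B : Set E3) : Set (E3 ≃ᵃ[ℝ] E3) := {φ | φ ∈ Sim ∧ φ '' A = B}

/-- The action of an affine transformation `x ↦ A x + b` on the complexified plane at
infinity: `[0 : x] ↦ [0 : A x]`. -/
def actInf (φ : E3 ≃ᵃ[ℝ] E3) (p : PInf) : PInf :=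
  Matrix.GeneralLinearGroup.map (algebraMap ℝ ℂ) (linMatrix φ) • p

/-! ### Real algebraic surfaces -/

/-- The real zero set in affine 3-space of a form `F(x₀, x₁, x₂, x₃)`. -/
def realLocus (F : MvPolynomial (Fin 4) ℝ) : Set E3 :=
  {x | eval (Fin.cons 1 x : Fin 4 → ℝ) F = 0}

/-- The dimension of a subset `A` of real affine 3-space in the sense of real algebraic
geometry: the Krull dimension of `ℝ[x₁, x₂, x₃] / I(A)`. -/
def realDim (A : Set E3) : WithBot ℕ∞ :=
  ringKrullDim (MvPolynomial (Fin 3) ℝ ⧸ (vanishingIdeal ℝ A : Ideal (MvPolynomial (Fin 3) ℝ)))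

/-- `F` is a form of degree `d`, irreducible over `ℂ`, whose real zero set is
two-dimensional. -/
structure IsSurfaceForm (d : ℕ) (F : MvPolynomial (Fin 4) ℝ) : Prop where
  isHomogeneous : F.IsHomogeneous d
  irreducible : Irreducible (map (algebraMap ℝ ℂ) F)
  dim : realDim (realLocus F) = 2

/-- Invariant under all translations in some direction. -/
def IsCylinder (A : Set E3) : Prop :=
  ∃ v : E3, v ≠ 0 ∧ ∀ t : ℝ, (fun x => x + t • v) '' A = A

/-- Invariant under all scalings (homotheties) with some centre. -/
def IsCone (A : Set E3) : Prop :=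
  ∃ c : E3, ∀ t : ℝ, t ≠ 0 → (fun x => c + t • (x - c)) '' A = A

/-- Invariant under all rotations about some axis. The rotations about the axis through `p`
with direction `u` are exactly the direct similarities fixing `p` and `p + u`. -/
def IsRevolution (A : Set E3) : Prop :=
  ∃ p u : E3, u ≠ 0 ∧ ∀ φ ∈ Sim, φ p = p → φ (p + u) = p + u → φ '' A = A

/-! ### The section at infinity -/

/-- `F(0, x₁, x₂, x₃)`. -/
def atInfinity (F : MvPolynomial (Fin 4) ℝ) : MvPolynomial (Fin 3) ℝ :=
  aeval (Fin.cons 0 X : Fin 4 → MvPolynomial (Fin 3) ℝ) F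

/-- `x₁² + x₂² + x₃²`. -/
def absForm : MvPolynomial (Fin 3) ℝ := ∑ i, X i ^ 2

/-- `F(0, x₁, x₂, x₃) = (x₁² + x₂² + x₃²)ᵏ F̃(x₁, x₂, x₃)` for some `k`, where
`x₁² + x₂² + x₃²` does not divide `F̃`. -/
def IsReducedInfinityPart (F : MvPolynomial (Fin 4) ℝ) (Ft : MvPolynomial (Fin 3) ℝ) : Prop :=
  (∃ k : ℕ, atInfinity F = absForm ^ k * Ft) ∧ ¬ absForm ∣ Ft

/-- The absolute conic `x₁² + x₂² + x₃² = 0` in the plane at infinity. -/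
def absConic : Set PInf := {p | Projectivization.orthogonal p p}

/-- `μ` is an isomorphism from the projective line onto the absolute conic, given by the
triple `m` of binary quadratic forms. -/
structure IsConicParam (μ : P1 → PInf) (m : Fin 3 → MvPolynomial (Fin 2) ℂ) : Prop where
  isHomogeneous : ∀ i, (m i).IsHomogeneous 2
  map_mk : ∀ (v : Fin 2 → ℂ) (hv : v ≠ 0), ∃ hw : (fun i => eval v (m i)) ≠ 0,
    μ (Projectivization.mk ℂ v hv) = Projectivization.mk ℂ (fun i => eval v (m i)) hw
  bijOn : Set.BijOn μ Set.univ absConic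

/-- The pull-back of a ternary form under the parametrization with component forms `m`. -/
def pullback (m : Fin 3 → MvPolynomial (Fin 2) ℂ) (H : MvPolynomial (Fin 3) ℝ) :
    MvPolynomial (Fin 2) ℂ := bind₁ m (map (algebraMap ℝ ℂ) H)

/-! ### Binary forms and automorphisms of the projective line -/

/-- The composition `P ∘ B` of a binary form with a linear substitution. -/
def comp (P : MvPolynomial (Fin 2) ℂ) (B : GL (Fin 2) ℂ) : MvPolynomial (Fin 2) ℂ :=
  bind₁ (fun i => ∑ j, C ((B : Matrix (Fin 2) (Fin 2) ℂ) i j) * X j) P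

/-- `Aut(ℙ¹)_{P,Q}`: the projective automorphisms `φ` with `Q ∘ φ = c P` for some `c ≠ 0`. -/
def autForms (P Q : MvPolynomial (Fin 2) ℂ) : Set (PGL(Fin 2, ℂ)) :=
  {φ | ∃ B : GL (Fin 2) ℂ, Matrix.ProjGenLinGroup.mk B = φ ∧ ∃ c : ℂ, c ≠ 0 ∧ comp Q B = c • P}

/-- The set of zeros of a binary form on the projective line. -/
def zeros (P : MvPolynomial (Fin 2) ℂ) : Set P1 := {p | eval p.rep P = 0}

end SurfaceSim

end

/-!
The vanishing ideal of the two-dimensional real zero set of an irreducible form is generated by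
the (dehomogenized) form, so a similarity `ψ` with `ψ(R) = S` pulls `G` back to a multiple of `F`.
At infinity its linear part `A` then pulls `G̃` back to a multiple of `F̃`. As `A` preserves
`x₁² + x₂² + x₃²` up to a factor, it is, through `μ`, the symmetric square of a binary matrix, whose
class in `PGL₂` is the candidate attached to `ψ`.

If two similarities agree on the absolute conic, their quotient has a real positive scalar linear
part, since isotropic vectors are then eigenvectors. It is thus a translation or a homothety
preserving `R`. A polynomial vanishing on an orbit of its iterates vanishes on the whole line
carrying the orbit, so that `R` would be a cylinder or a cone unless the quotient is the identity.

Zeros of the pull-back of a real form come in complex conjugate pairs, and the two members of a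
pair are distinct because no nonzero isotropic vector is proportional to its conjugate. Finally, an
element of `PGL₂` is determined by its values at three points.
-/

namespace SurfaceSim

/-! ### Homogeneous polynomials -/

theorem eval_aeval {σ τ R : Type*} [CommSemiring R] (g : σ → MvPolynomial τ R) (v : τ → R)
    (p : MvPolynomial σ R) : eval v (aeval g p) = eval (fun i => eval v (g i)) p :=
  (eval_assoc g v p).symm

section Homogeneous

variable {σ R : Type*}

theorem eval_smul_of_isHomogeneous [CommSemiring R] {n : ℕ} {P : MvPolynomial σ R}
    (hP : P.IsHomogeneous n) (c : R) (v : σ → R) : eval (c • v) P = c ^ n * eval v P := by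
  rw [eval_eq, eval_eq, Finset.mul_sum]
  refine Finset.sum_congr rfl fun e he => ?_
  simp only [Pi.smul_apply, smul_eq_mul, mul_pow, Finset.prod_mul_distrib,
    Finset.prod_pow_eq_pow_sum, ← hP.degree_eq_sum_deg_support he]
  ring

attribute [local instance] MvPolynomial.gradedAlgebra in
theorem homogeneousComponent_add_mul [CommSemiring R] {k : ℕ} {a : MvPolynomial σ R}
    (ha : a.IsHomogeneous k) (i : ℕ) (b : MvPolynomial σ R) :
    homogeneousComponent (k + i) (a * b) = a * homogeneousComponent i b := by
  simp only [← decomposition.decompose'_apply]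
  exact DirectSum.coe_decompose_mul_add_of_left_mem (homogeneousSubmodule σ R) ha

theorem isHomogeneous_sub_of_mul [CommSemiring R] [NoZeroDivisors R] {k d : ℕ}
    {a b : MvPolynomial σ R} (ha : a.IsHomogeneous k) (ha0 : a ≠ 0)
    (hab : (a * b).IsHomogeneous d) : b.IsHomogeneous (d - k) := by
  rw [← sum_homogeneousComponent b]
  refine IsHomogeneous.sum _ _ _ fun i _ => ?_
  by_cases hi : homogeneousComponent i b = 0
  · exact hi ▸ isHomogeneous_zero _ _ _
  have hdeg : k + i = d := by
    by_contra hne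
    refine mul_ne_zero ha0 hi ?_
    rw [← homogeneousComponent_add_mul ha, homogeneousComponent_of_mem hab, if_neg hne]
  rw [← hdeg, Nat.add_sub_cancel_left]
  exact homogeneousComponent_isHomogeneous i b

theorem exists_eq_C_mul_of_dvd [CommRing R] [IsDomain R] {d : ℕ} {F H : MvPolynomial σ R}
    (hF : F.IsHomogeneous d) (hH : H.IsHomogeneous d) (hH0 : H ≠ 0) (hdvd : F ∣ H) :
    ∃ c : R, c ≠ 0 ∧ H = C c * F := by
  obtain ⟨K, rfl⟩ := hdvd
  have hK : K.IsHomogeneous 0 := by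
    simpa only [Nat.sub_self] using isHomogeneous_sub_of_mul hF (left_ne_zero_of_mul hH0) hH
  have hKC := totalDegree_eq_zero_iff_eq_C.1 ((totalDegree_zero_iff_isHomogeneous σ).2 hK)
  refine ⟨coeff 0 K, fun h => hH0 ?_, by rw [← hKC, mul_comm]⟩
  rw [hKC, h, map_zero, mul_zero]

end Homogeneous

theorem irreducible_of_irreducible_map {σ K L : Type*} [Field K] [Field L] (f : K →+* L)
    {F : MvPolynomial σ K} (hF : Irreducible (map f F)) : Irreducible F := by
  have isUnit_of_map (a : MvPolynomial σ K) (ha : IsUnit (map f a)) : IsUnit a := by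
    rw [isUnit_iff_totalDegree_of_isReduced] at ha ⊢
    rw [coeff_map, isUnit_map_iff, totalDegree, support_map_of_injective _ f.injective] at ha
    exact ha
  refine ⟨fun h => hF.not_isUnit (h.map _), fun a b h => ?_⟩
  rw [h, map_mul] at hF
  exact (hF.isUnit_or_isUnit rfl).imp (isUnit_of_map a) (isUnit_of_map b)

/-! ### Dehomogenization -/

section Dehomogenization

variable {R : Type*} [CommRing R] {n : ℕ}

theorem eval_aeval_cons (a : MvPolynomial (Fin n) R) (F : MvPolynomial (Fin (n + 1)) R)
    (x : Fin n → R) :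
    eval x (aeval (Fin.cons a X : Fin (n + 1) → MvPolynomial (Fin n) R) F) =
      eval (Fin.cons (eval x a) x : Fin (n + 1) → R) F := by
  rw [eval_aeval]
  congr 2
  exact funext (Fin.cases (by simp) (by simp))

/-- The dehomogenization `F(1, x₁, …, xₙ)` of a polynomial `F(x₀, …, xₙ)`. -/
noncomputable def dehom : MvPolynomial (Fin (n + 1)) R →ₐ[R] MvPolynomial (Fin n) R :=
  aeval (Fin.cons 1 X : Fin (n + 1) → MvPolynomial (Fin n) R)

theorem dehom_X_zero : dehom (X 0 : MvPolynomial (Fin (n + 1)) R) = 1 := by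
  rw [dehom, aeval_X, Fin.cons_zero]

theorem dehom_rename_succ (a : MvPolynomial (Fin n) R) : dehom (rename Fin.succ a) = a := by
  rw [dehom, aeval_rename]
  exact aeval_X_left_apply a

theorem eval_dehom (F : MvPolynomial (Fin (n + 1)) R) (x : Fin n → R) :
    eval x (dehom F) = eval (Fin.cons 1 x : Fin (n + 1) → R) F := by
  rw [dehom, eval_aeval_cons, map_one]

theorem dehom_eq_eval_finSuccEquiv (F : MvPolynomial (Fin (n + 1)) R) :
    dehom F = (finSuccEquiv R n F).eval 1 := by
  rw [dehom]
  induction F using MvPolynomial.induction_on with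
  | C c => simp [finSuccEquiv_apply]
  | add p q hp hq => simp only [map_add, hp, hq, Polynomial.eval_add]
  | mul_X p i hp =>
    rw [map_mul, map_mul, Polynomial.eval_mul, hp, aeval_X]
    refine i.cases ?_ fun j => ?_ <;> simp [finSuccEquiv_X_zero, finSuccEquiv_X_succ]

theorem eq_zero_of_dehom_eq_zero {d : ℕ} {H : MvPolynomial (Fin (n + 1)) R}
    (hH : H.IsHomogeneous d) (h : dehom H = 0) : H = 0 := by
  have hdeg : (finSuccEquiv R n H).natDegree < d + 1 := by
    rw [natDegree_finSuccEquiv, Nat.lt_succ_iff]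
    exact (degreeOf_le_totalDegree H 0).trans hH.totalDegree_le
  have hsum : ∑ j ∈ Finset.range (d + 1), (finSuccEquiv R n H).coeff j = 0 := by
    simpa only [h, Polynomial.eval_eq_sum_range' hdeg, one_pow, mul_one] using
      (dehom_eq_eval_finSuccEquiv H).symm
  refine (finSuccEquiv R n).injective (Polynomial.ext fun i => ?_)
  rw [map_zero, Polynomial.coeff_zero]
  obtain hi | hi := Nat.lt_or_ge i (d + 1)
  · have hcomp := congrArg (homogeneousComponent (d - i)) hsum
    rw [map_zero, map_sum, Finset.sum_eq_single_of_mem i (Finset.mem_range.2 hi)] at hcomp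
    · rwa [homogeneousComponent_of_mem (hH.finSuccEquiv_coeff_isHomogeneous i (d - i) (by omega)),
        if_pos rfl] at hcomp
    · intro j hj hji
      have hj := Finset.mem_range.1 hj
      rw [homogeneousComponent_of_mem (hH.finSuccEquiv_coeff_isHomogeneous j (d - j) (by omega)),
        if_neg (by omega)]
  · exact Polynomial.coeff_eq_zero_of_natDegree_lt (by omega)

theorem X_zero_pow_mul_eq_of_dehom_eq {k l : ℕ} {A B : MvPolynomial (Fin (n + 1)) R}
    (hA : A.IsHomogeneous k) (hB : B.IsHomogeneous l) (h : dehom A = dehom B) :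
    X 0 ^ l * A = X 0 ^ k * B := by
  have hA' := (isHomogeneous_X_pow (R := R) (0 : Fin (n + 1)) l).mul hA
  have hB' := (isHomogeneous_X_pow (R := R) (0 : Fin (n + 1)) k).mul hB
  refine sub_eq_zero.1 (eq_zero_of_dehom_eq_zero (hA'.sub (add_comm k l ▸ hB')) ?_)
  simp only [map_sub, map_mul, map_pow, dehom_X_zero, one_pow, one_mul, h, sub_self]

theorem exists_homogenization (a : MvPolynomial (Fin n) R) :
    ∃ A : MvPolynomial (Fin (n + 1)) R, A.IsHomogeneous a.totalDegree ∧ dehom A = a := by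
  refine ⟨∑ i ∈ Finset.range (a.totalDegree + 1),
    X 0 ^ (a.totalDegree - i) * rename Fin.succ (homogeneousComponent i a), ?_, ?_⟩
  · refine IsHomogeneous.sum _ _ _ fun i hi => ?_
    have hmul := (isHomogeneous_X_pow (R := R) (0 : Fin (n + 1)) (a.totalDegree - i)).mul
      ((homogeneousComponent_isHomogeneous i a).rename_isHomogeneous (f := Fin.succ))
    rwa [Nat.sub_add_cancel (Nat.lt_succ_iff.1 (Finset.mem_range.1 hi))] at hmul
  · simp only [map_sum, map_mul, map_pow, dehom_X_zero, one_pow, one_mul, dehom_rename_succ,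
      sum_homogeneousComponent]

theorem dvd_of_dehom_dvd {d e : ℕ} {F H : MvPolynomial (Fin (n + 1)) R} (hF : F.IsHomogeneous d)
    (hprime : Prime F) (hu : ¬ IsUnit (dehom F)) (hH : H.IsHomogeneous e)
    (hdvd : dehom F ∣ dehom H) : F ∣ H := by
  obtain ⟨a, ha⟩ := hdvd
  obtain ⟨A, hA, rfl⟩ := exists_homogenization a
  have heq := X_zero_pow_mul_eq_of_dehom_eq hH (hF.mul hA) (by rw [ha, map_mul])
  refine (hprime.dvd_or_dvd (heq.symm ▸ (dvd_mul_right F A).mul_left _)).resolve_left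
    fun hX => hu (isUnit_of_dvd_one ?_)
  simpa only [dehom_X_zero] using map_dvd dehom (hprime.dvd_of_dvd_pow hX)

theorem prime_dehom {d : ℕ} {F : MvPolynomial (Fin (n + 1)) R} (hF : F.IsHomogeneous d)
    (hprime : Prime F) (hu : ¬ IsUnit (dehom F)) : Prime (dehom F) := by
  refine ⟨fun h => hprime.ne_zero (eq_zero_of_dehom_eq_zero hF h), hu, fun a b hab => ?_⟩
  obtain ⟨A, hA, rfl⟩ := exists_homogenization a
  obtain ⟨B, hB, rfl⟩ := exists_homogenization b
  rw [← map_mul] at hab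
  exact (hprime.dvd_or_dvd (dvd_of_dehom_dvd hF hprime hu (hA.mul hB) hab)).imp
    (map_dvd dehom) (map_dvd dehom)

end Dehomogenization

/-! ### Polynomials vanishing on a two-dimensional real surface -/

theorem ringKrullDim_quotient_add_two_le {R : Type*} [CommRing R] [IsDomain R] {I : Ideal R}
    {f h : R} (hf : Prime f) (hfI : f ∈ I) (hhI : h ∈ I) (hndvd : ¬ f ∣ h) :
    ringKrullDim (R ⧸ I) + 1 + 1 ≤ ringKrullDim R := by
  set J : Ideal R := Ideal.span {f}
  have hJ : J.IsPrime := (Ideal.span_singleton_prime hf.ne_zero).2 hf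
  have hJI : J ≤ I := (Ideal.span_singleton_le_iff_mem _).2 hfI
  set h' : R ⧸ J := Ideal.Quotient.mk J h
  have hh' : h' ≠ 0 := by
    rwa [Ne, Ideal.Quotient.eq_zero_iff_mem, Ideal.mem_span_singleton]
  have hvanish : ∀ a ∈ Ideal.span {h'}, Ideal.Quotient.factor hJI a = 0 := by
    intro a ha
    obtain ⟨b, rfl⟩ := Ideal.mem_span_singleton.1 ha
    rw [map_mul, Ideal.Quotient.factor_mk, Ideal.Quotient.eq_zero_iff_mem.2 hhI, zero_mul]
  calc ringKrullDim (R ⧸ I) + 1 + 1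
      ≤ ringKrullDim ((R ⧸ J) ⧸ Ideal.span {h'}) + 1 + 1 := by
        gcongr
        exact ringKrullDim_le_of_surjective _ (Ideal.Quotient.lift_surjective_of_surjective _
          hvanish (Ideal.Quotient.factor_surjective hJI))
    _ ≤ ringKrullDim (R ⧸ J) + 1 := by
        gcongr
        exact ringKrullDim_quotient_succ_le_of_nonZeroDivisor (mem_nonZeroDivisors_of_ne_zero hh')
    _ ≤ ringKrullDim R := ringKrullDim_quotient_succ_le_of_nonZeroDivisor
        (mem_nonZeroDivisors_of_ne_zero hf.ne_zero)

theorem not_isUnit_of_realDim_eq_two {f : MvPolynomial (Fin 3) ℝ} {A : Set E3}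
    (hdim : realDim A = 2) (hf : f ∈ vanishingIdeal ℝ A) : ¬ IsUnit f := by
  intro hu
  have := Ideal.Quotient.subsingleton_iff.2 (Ideal.eq_top_of_isUnit_mem _ hf hu)
  rw [realDim, ringKrullDim_eq_bot_of_subsingleton] at hdim
  exact absurd hdim (by decide)

theorem dvd_of_realDim_eq_two {f h : MvPolynomial (Fin 3) ℝ} {A : Set E3}
    (hdim : realDim A = 2) (hprime : Prime f) (hf : f ∈ vanishingIdeal ℝ A)
    (hh : h ∈ vanishingIdeal ℝ A) : f ∣ h := by
  by_contra hndvd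
  have hle := ringKrullDim_quotient_add_two_le hprime hf hh hndvd
  rw [show ringKrullDim (MvPolynomial (Fin 3) ℝ ⧸ vanishingIdeal ℝ A) = 2 from hdim,
    MvPolynomial.ringKrullDim_of_isNoetherianRing, ringKrullDim_eq_zero_of_field,
    Nat.card_eq_fintype_card, Fintype.card_fin, zero_add] at hle
  exact absurd hle (by decide)

theorem dehom_mem_vanishingIdeal_iff {F : MvPolynomial (Fin 4) ℝ} {A : Set E3} :
    dehom F ∈ vanishingIdeal ℝ A ↔ A ⊆ realLocus F :=
  mem_vanishingIdeal_iff.trans <| forall₂_congr fun x _ => by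
    change eval x (dehom F) = 0 ↔ eval (Fin.cons 1 x : Fin 4 → ℝ) F = 0
    rw [eval_dehom]

theorem dvd_of_realLocus_subset {d e : ℕ} {F H : MvPolynomial (Fin 4) ℝ}
    (hF : F.IsHomogeneous d) (hirr : Irreducible F) (hdim : realDim (realLocus F) = 2)
    (hH : H.IsHomogeneous e) (hsub : realLocus F ⊆ realLocus H) : F ∣ H := by
  have hFmem := dehom_mem_vanishingIdeal_iff.2 (Set.Subset.refl (realLocus F))
  have hu := not_isUnit_of_realDim_eq_two hdim hFmem
  exact dvd_of_dehom_dvd hF hirr.prime hu hH (dvd_of_realDim_eq_two hdim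
    (prime_dehom hF hirr.prime hu) hFmem (dehom_mem_vanishingIdeal_iff.2 hsub))

/-! ### Linear substitutions -/

section LinearSubstitution

variable {R : Type*} [CommSemiring R] {l m n : Type*} [Fintype n]

/-- The substitution `p ↦ p ∘ M` of the linear forms given by the rows of `M`. -/
noncomputable def linSubst (M : Matrix m n R) : MvPolynomial m R →ₐ[R] MvPolynomial n R :=
  bind₁ M.toMvPolynomial

theorem eval_linSubst (M : Matrix m n R) (p : MvPolynomial m R) (v : n → R) :
    eval v (linSubst M p) = eval (M.mulVec v) p := by
  rw [linSubst, bind₁, eval_aeval]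
  simp only [Matrix.toMvPolynomial_eval_eq_apply]

theorem linSubst_linSubst [Fintype m] (M : Matrix m n R) (N : Matrix l m R) (p : MvPolynomial l R) :
    linSubst M (linSubst N p) = linSubst (N * M) p := by
  rw [linSubst, linSubst, linSubst, bind₁_bind₁]
  simp only [← Matrix.toMvPolynomial_mul]

theorem linSubst_one [DecidableEq n] (p : MvPolynomial n R) :
    linSubst (1 : Matrix n n R) p = p := by
  rw [linSubst, Matrix.toMvPolynomial_one, bind₁_X_left, AlgHom.id_apply]

theorem map_linSubst {S : Type*} [CommSemiring S] (f : R →+* S) (M : Matrix m n R)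
    (p : MvPolynomial m R) : map f (linSubst M p) = linSubst (M.map f) (map f p) := by
  rw [linSubst, linSubst, map_bind₁]
  simp only [← Matrix.toMvPolynomial_map]

theorem isHomogeneous_linSubst {d : ℕ} {p : MvPolynomial m R} (hp : p.IsHomogeneous d)
    (M : Matrix m n R) : (linSubst M p).IsHomogeneous d :=
  one_mul d ▸ hp.aeval _ (Matrix.toMvPolynomial_isHomogeneous M)

end LinearSubstitution

theorem comp_eq_linSubst (P : MvPolynomial (Fin 2) ℂ) (B : GL (Fin 2) ℂ) :
    comp P B = linSubst (B : Matrix (Fin 2) (Fin 2) ℂ) P := by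
  simp only [comp, linSubst, C_mul_X_eq_monomial]
  rfl

section AffineSubstitution

variable {R : Type*} [CommRing R] {n : ℕ}

/-- The matrix of the affine map `x ↦ M x + b` in homogeneous coordinates, with the
coordinate at infinity in position `0`. -/
def affMatrix (M : Matrix (Fin n) (Fin n) R) (b : Fin n → R) :
    Matrix (Fin (n + 1)) (Fin (n + 1)) R :=
  Matrix.of (Fin.cons (Fin.cons 1 0) fun i => Fin.cons (b i) (M i))

theorem affMatrix_mulVec_cons (M : Matrix (Fin n) (Fin n) R) (b : Fin n → R) (t : R)
    (x : Fin n → R) :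
    (affMatrix M b).mulVec (Fin.cons t x) = Fin.cons t (M.mulVec x + t • b) := by
  ext i
  refine i.cases ?_ fun j => ?_ <;>
    simp [affMatrix, Matrix.mulVec, dotProduct, Fin.sum_univ_succ, mul_comm, add_comm]

end AffineSubstitution

/-! ### Similarities acting on forms -/

theorem linMatrix_mulVec (ψ : E3 ≃ᵃ[ℝ] E3) (x : E3) :
    (linMatrix ψ : Matrix (Fin 3) (Fin 3) ℝ).mulVec x = ψ.linear x := by
  have htoLin : Matrix.GeneralLinearGroup.toLin (linMatrix ψ) =
      (LinearMap.GeneralLinearGroup.generalLinearEquiv ℝ E3).symm ψ.linear :=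
    MulEquiv.apply_symm_apply _ _
  exact congrArg (fun u : LinearMap.GeneralLinearGroup ℝ E3 => (u : E3 →ₗ[ℝ] E3) x) htoLin

theorem apply_eq_mulVec_add (ψ : E3 ≃ᵃ[ℝ] E3) (x : E3) :
    ψ x = (linMatrix ψ : Matrix (Fin 3) (Fin 3) ℝ).mulVec x + ψ 0 := by
  rw [linMatrix_mulVec]
  simpa only [vadd_eq_add, add_zero] using ψ.map_vadd 0 x

theorem eval_linSubst_affMatrix (ψ : E3 ≃ᵃ[ℝ] E3) (G : MvPolynomial (Fin 4) ℝ) (x : E3) :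
    eval (Fin.cons 1 x : Fin 4 → ℝ) (linSubst (affMatrix (linMatrix ψ).val (ψ 0)) G) =
      eval (Fin.cons 1 (ψ x) : Fin 4 → ℝ) G := by
  rw [eval_linSubst, affMatrix_mulVec_cons, one_smul, ← apply_eq_mulVec_add]

theorem linSubst_affMatrix_ne_zero {d : ℕ} {G : MvPolynomial (Fin 4) ℝ} (hG : G.IsHomogeneous d)
    (hG0 : G ≠ 0) (ψ : E3 ≃ᵃ[ℝ] E3) : linSubst (affMatrix (linMatrix ψ).val (ψ 0)) G ≠ 0 := by
  refine fun h0 => hG0 (eq_zero_of_dehom_eq_zero hG (MvPolynomial.funext fun y => ?_))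
  rw [map_zero, eval_dehom, ← ψ.apply_symm_apply y, ← eval_linSubst_affMatrix, h0, map_zero]

theorem exists_linSubst_affMatrix_eq {d : ℕ} {F G : MvPolynomial (Fin 4) ℝ}
    (hF : F.IsHomogeneous d) (hirr : Irreducible F) (hdim : realDim (realLocus F) = 2)
    (hG : G.IsHomogeneous d) (hG0 : G ≠ 0) {ψ : E3 ≃ᵃ[ℝ] E3}
    (hψ : Set.MapsTo ψ (realLocus F) (realLocus G)) :
    ∃ c : ℝ, c ≠ 0 ∧ linSubst (affMatrix (linMatrix ψ).val (ψ 0)) G = C c * F := by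
  have hH := isHomogeneous_linSubst hG (affMatrix (linMatrix ψ).val (ψ 0))
  refine exists_eq_C_mul_of_dvd hF hH (linSubst_affMatrix_ne_zero hG hG0 ψ)
    (dvd_of_realLocus_subset hF hirr hdim hH fun x hx => ?_)
  exact (eval_linSubst_affMatrix ψ G x).trans (hψ hx)

theorem eval_atInfinity (F : MvPolynomial (Fin 4) ℝ) (x : E3) :
    eval x (atInfinity F) = eval (Fin.cons 0 x : Fin 4 → ℝ) F := by
  rw [atInfinity, eval_aeval_cons, map_zero]

theorem linSubst_atInfinity (M : Matrix (Fin 3) (Fin 3) ℝ) (b : E3) (G : MvPolynomial (Fin 4) ℝ) :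
    linSubst M (atInfinity G) = atInfinity (linSubst (affMatrix M b) G) := by
  refine MvPolynomial.funext fun x => ?_
  rw [eval_linSubst, eval_atInfinity, eval_atInfinity, eval_linSubst, affMatrix_mulVec_cons,
    zero_smul, add_zero]

theorem atInfinity_C_mul (c : ℝ) (F : MvPolynomial (Fin 4) ℝ) :
    atInfinity (C c * F) = C c * atInfinity F := by
  rw [atInfinity, map_mul, aeval_C, algebraMap_eq, atInfinity]

theorem isHomogeneous_atInfinity {d : ℕ} {F : MvPolynomial (Fin 4) ℝ} (hF : F.IsHomogeneous d) :
    (atInfinity F).IsHomogeneous d := by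
  refine one_mul d ▸ hF.aeval _ (Fin.cases ?_ fun j => ?_)
  · exact isHomogeneous_zero _ _ _
  · exact isHomogeneous_X _ j

/-! ### Removing the absolute conic -/

theorem eval_absForm (x : E3) : eval x absForm = x ⬝ᵥ x := by
  simp [absForm, dotProduct, sq]

theorem isHomogeneous_absForm : absForm.IsHomogeneous 2 :=
  IsHomogeneous.sum _ _ _ fun i _ => isHomogeneous_X_pow i 2

theorem absForm_ne_zero : absForm ≠ 0 := by
  intro h
  have heval := eval_absForm 1
  norm_num [h] at heval

theorem linSubst_absForm {M : Matrix (Fin 3) (Fin 3) ℝ} {a : ℝ} (h : M.transpose * M = a • 1) :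
    linSubst M absForm = C a * absForm := by
  refine MvPolynomial.funext fun x => ?_
  rw [eval_linSubst, map_mul, eval_C, eval_absForm, eval_absForm, Matrix.dotProduct_mulVec,
    Matrix.vecMul_mulVec, h, Matrix.vecMul_smul, Matrix.vecMul_one, smul_dotProduct, smul_eq_mul]

theorem absForm_dvd_of_dvd_linSubst {A : GL (Fin 3) ℝ} (hA : A ∈ similitude)
    {H : MvPolynomial (Fin 3) ℝ} (h : absForm ∣ linSubst A.val H) : absForm ∣ H := by
  obtain ⟨⟨a, -, hAA⟩, -⟩ := similitude.inv_mem hA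
  have hdvd := map_dvd (linSubst (A⁻¹).val) h
  rw [linSubst_linSubst, ← Units.val_mul, mul_inv_cancel, Units.val_one, linSubst_one,
    linSubst_absForm hAA] at hdvd
  exact dvd_of_mul_left_dvd hdvd

theorem eq_of_pow_mul_eq_pow_mul {M : Type*} [CommMonoidWithZero M] [IsCancelMulZero M]
    {q p p' : M} {k l : ℕ} (hq : q ≠ 0) (hp : ¬ q ∣ p) (hp' : ¬ q ∣ p')
    (h : q ^ k * p = q ^ l * p') : p = p' := by
  wlog hkl : k ≤ l generalizing k l p p'
  · exact (this hp' hp h.symm (le_of_not_ge hkl)).symm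
  obtain ⟨e, rfl⟩ := Nat.exists_eq_add_of_le hkl
  rw [pow_add, mul_assoc] at h
  have hpe : p = q ^ e * p' := mul_left_cancel₀ (pow_ne_zero k hq) h
  obtain rfl : e = 0 := by
    by_contra he
    exact hp (hpe ▸ (dvd_pow_self q he).mul_right p')
  rwa [pow_zero, one_mul] at hpe

theorem C_mul_dvd_iff {σ K : Type*} [Field K] {c : K} (hc : c ≠ 0) {p q : MvPolynomial σ K} :
    q ∣ C c * p ↔ q ∣ p :=
  ((isUnit_iff_ne_zero.2 hc).map C).dvd_mul_left

theorem IsReducedInfinityPart.exists_linSubst_eq {F G : MvPolynomial (Fin 4) ℝ}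
    {Ft Gt : MvPolynomial (Fin 3) ℝ} (hFt : IsReducedInfinityPart F Ft)
    (hGt : IsReducedInfinityPart G Gt) {A : GL (Fin 3) ℝ} (hA : A ∈ similitude) {c : ℝ}
    (hc : c ≠ 0) (h : linSubst A.val (atInfinity G) = C c * atInfinity F) :
    ∃ c' : ℝ, c' ≠ 0 ∧ linSubst A.val Gt = C c' * Ft := by
  obtain ⟨⟨k, hk⟩, hFd⟩ := hFt
  obtain ⟨⟨l, hl⟩, hGd⟩ := hGt
  obtain ⟨⟨a, ha, hAA⟩, -⟩ := id hA
  have hal : a ^ l ≠ 0 := pow_ne_zero l ha.ne'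
  have hscaled : C (a ^ l) * linSubst A.val Gt = C c * Ft := by
    refine eq_of_pow_mul_eq_pow_mul (k := l) (l := k) absForm_ne_zero ?_ ?_ ?_
    · exact fun hd => hGd (absForm_dvd_of_dvd_linSubst hA ((C_mul_dvd_iff hal).1 hd))
    · exact fun hd => hFd ((C_mul_dvd_iff hc).1 hd)
    · rw [hl, hk, map_mul, map_pow, linSubst_absForm hAA] at h
      rw [C_pow]
      linear_combination h
  refine ⟨(a ^ l)⁻¹ * c, mul_ne_zero (inv_ne_zero hal) hc, ?_⟩
  rw [C_mul, mul_assoc, ← hscaled, ← mul_assoc, ← C_mul, inv_mul_cancel₀ hal, C_1, one_mul]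

theorem IsReducedInfinityPart.exists_isHomogeneous {d : ℕ} {F : MvPolynomial (Fin 4) ℝ}
    {Ft : MvPolynomial (Fin 3) ℝ} (h : IsReducedInfinityPart F Ft) (hF : F.IsHomogeneous d) :
    ∃ n, Ft.IsHomogeneous n := by
  obtain ⟨⟨k, hk⟩, -⟩ := h
  exact ⟨_, isHomogeneous_sub_of_mul (isHomogeneous_absForm.pow k)
    (pow_ne_zero k absForm_ne_zero) (hk ▸ isHomogeneous_atInfinity hF)⟩

/-! ### Translations and homotheties preserving a surface -/

theorem eval_line_eq_zero {σ R : Type*} [CommRing R] [IsDomain R] {f : MvPolynomial σ R}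
    {x b : σ → R} {T : Set R} (hT : T.Infinite) (h : ∀ t ∈ T, eval (x + t • b) f = 0) (t : R) :
    eval (x + t • b) f = 0 := by
  set p : Polynomial R := aeval (fun i => Polynomial.C (x i) + Polynomial.C (b i) * Polynomial.X) f
  have heval (t : R) : p.eval t = eval (x + t • b) f := by
    rw [show p = eval₂ _ _ f from aeval_def _ f, polynomial_eval_eval₂]
    congr 1
    · ext r; simp
    · ext i; simp [mul_comm t]
  have hp : p = 0 := Polynomial.eq_zero_of_infinite_isRoot p
    (hT.mono fun t ht => (heval t).trans (h t ht))
  rw [← heval, hp, Polynomial.eval_zero]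

theorem add_smul_mem_realLocus {F : MvPolynomial (Fin 4) ℝ} {x b : E3} {T : Set ℝ}
    (hT : T.Infinite) (h : ∀ t ∈ T, x + t • b ∈ realLocus F) (t : ℝ) :
    x + t • b ∈ realLocus F := by
  have hmem (y : E3) : y ∈ realLocus F ↔ eval y (dehom F) = 0 := by rw [eval_dehom]; rfl
  simp only [hmem] at h ⊢
  exact eval_line_eq_zero hT h t

theorem image_eq_of_mapsTo_of_rightInverse {α : Type*} {A : Set α} {g g' : α → α}
    (h : Set.MapsTo g A A) (h' : Set.MapsTo g' A A) (hgg' : Function.RightInverse g' g) :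
    g '' A = A :=
  h.image_subset.antisymm fun x hx => ⟨g' x, h' hx, hgg' x⟩

theorem isCylinder_realLocus_of_mapsTo_add {F : MvPolynomial (Fin 4) ℝ} {b : E3} (hb : b ≠ 0)
    (h : Set.MapsTo (fun x => x + b) (realLocus F) (realLocus F)) : IsCylinder (realLocus F) := by
  have htranslate (t : ℝ) : Set.MapsTo (fun x => x + t • b) (realLocus F) (realLocus F) := by
    refine fun x hx => add_smul_mem_realLocus (T := Set.range ((↑) : ℕ → ℝ))
      (Set.infinite_range_of_injective Nat.cast_injective) ?_ t
    rintro _ ⟨n, rfl⟩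
    induction n with
    | zero => simpa using hx
    | succ n ih => simpa [add_smul, add_assoc] using h ih
  exact ⟨b, hb, fun t => image_eq_of_mapsTo_of_rightInverse (htranslate t) (htranslate (-t))
    fun x => by module⟩

theorem isCone_realLocus_of_mapsTo_homothety {F : MvPolynomial (Fin 4) ℝ} {c : E3} {r : ℝ}
    (hr : 0 < r) (hr1 : r ≠ 1)
    (h : Set.MapsTo (fun x => c + r • (x - c)) (realLocus F) (realLocus F)) :
    IsCone (realLocus F) := by
  have hscale (t : ℝ) : Set.MapsTo (fun x => c + t • (x - c)) (realLocus F) (realLocus F) := by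
    refine fun x hx => add_smul_mem_realLocus (T := Set.range (r ^ · : ℕ → ℝ))
      (Set.infinite_range_of_injective (pow_right_injective₀ hr hr1)) ?_ t
    rintro _ ⟨n, rfl⟩
    induction n with
    | zero => simpa using hx
    | succ n ih => simpa [pow_succ', mul_smul] using h ih
  exact ⟨c, fun t ht => image_eq_of_mapsTo_of_rightInverse (hscale t) (hscale t⁻¹)
    fun x => by simp [smul_smul, ht]⟩

theorem eq_one_of_mapsTo_of_apply_eq_smul_add {F : MvPolynomial (Fin 4) ℝ}
    (hcyl : ¬ IsCylinder (realLocus F)) (hcone : ¬ IsCone (realLocus F)) {φ : E3 ≃ᵃ[ℝ] E3}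
    (hφ : Set.MapsTo φ (realLocus F) (realLocus F)) {r : ℝ} (hr : 0 < r)
    (hlin : ∀ x, φ x = r • x + φ 0) : φ = 1 := by
  obtain rfl : r = 1 := by
    by_contra hr1
    refine hcone (isCone_realLocus_of_mapsTo_homothety (c := (1 - r)⁻¹ • φ 0) hr hr1 ?_)
    have hfix : φ 0 = (1 - r) • (1 - r)⁻¹ • φ 0 :=
      (smul_inv_smul₀ (sub_ne_zero.2 (Ne.symm hr1)) _).symm
    convert hφ using 2 with x
    rw [hlin x]
    nth_rewrite 3 [hfix]
    module
  have hb : φ 0 = 0 := by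
    by_contra hb
    refine hcyl (isCylinder_realLocus_of_mapsTo_add hb ?_)
    convert hφ using 2 with x
    rw [hlin x, one_smul]
  ext x : 1
  rw [hlin, hb, one_smul, add_zero, AffineEquiv.coe_one, id]

/-! ### Isotropic vectors -/

section Isotropic

variable {ι : Type*} [Fintype ι]

theorem dotProduct_self_single_add_smul_single [DecidableEq ι] {R : Type*} [CommRing R]
    {i j : ι} (hij : i ≠ j) {c : R} (hc : c ^ 2 = -1) :
    (Pi.single i 1 + c • Pi.single j 1 : ι → R) ⬝ᵥ (Pi.single i 1 + c • Pi.single j 1) = 0 := by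
  simp [dotProduct_add, hij, hij.symm, ← sq, hc]

theorem span_isotropic_eq_top [Nontrivial ι] :
    Submodule.span ℂ {w : ι → ℂ | w ⬝ᵥ w = 0} = ⊤ := by
  classical
  refine eq_top_iff.2 ((Pi.basisFun ℂ ι).span_eq.symm.trans_le (Submodule.span_le.2 ?_))
  rintro _ ⟨i, rfl⟩
  obtain ⟨j, hji⟩ := exists_ne i
  have hmem {c : ℂ} (hc : c ^ 2 = -1) : (Pi.single i 1 + c • Pi.single j 1 : ι → ℂ) ∈
      Submodule.span ℂ {w : ι → ℂ | w ⬝ᵥ w = 0} :=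
    Submodule.subset_span (dotProduct_self_single_add_smul_single hji.symm hc)
  have hsingle : (Pi.single i 1 : ι → ℂ) = (1 / 2 : ℂ) • ((Pi.single i 1 +
      Complex.I • Pi.single j 1) + (Pi.single i 1 + (-Complex.I) • Pi.single j 1)) := by module
  rw [Pi.basisFun_apply, hsingle]
  exact Submodule.smul_mem _ _ (Submodule.add_mem _ (hmem Complex.I_sq)
    (hmem (by rw [neg_sq, Complex.I_sq])))

theorem exists_eq_smul_one_of_isotropic_eigenvectors [DecidableEq ι] (hι : 2 < Fintype.card ι)
    {A : Matrix ι ι ℂ} (h : ∀ w, w ⬝ᵥ w = 0 → ∃ c : ℂ, A.mulVec w = c • w) :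
    ∃ r : ℂ, A = r • 1 := by
  have heig {i j : ι} (hij : i ≠ j) {e : ℂ} (he : e ^ 2 = -1) : ∃ c : ℂ, ∀ k,
      A k i + e * A k j = c * ((Pi.single i 1 : ι → ℂ) k + e * (Pi.single j 1 : ι → ℂ) k) := by
    obtain ⟨c, hc⟩ := h _ (dotProduct_self_single_add_smul_single hij he)
    refine ⟨c, fun k => ?_⟩
    simpa [Matrix.mulVec_add, Matrix.mulVec_smul] using congrFun hc k
  have hoff {k i : ι} (hki : k ≠ i) : A k i = 0 := by
    obtain ⟨j, hj⟩ : ∃ j, j ∉ ({k, i} : Finset ι) := by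
      by_contra! hall
      exact (Finset.card_le_two.trans_lt hι).ne
        (congrArg Finset.card (Finset.eq_univ_of_forall hall))
    simp only [Finset.mem_insert, Finset.mem_singleton, not_or] at hj
    obtain ⟨c, hc⟩ := heig (Ne.symm hj.2) Complex.I_sq
    obtain ⟨c', hc'⟩ := heig (Ne.symm hj.2) (show (-Complex.I) ^ 2 = -1 by simp)
    have hc := hc k
    have hc' := hc' k
    simp only [Pi.single_eq_of_ne hki, Pi.single_eq_of_ne (Ne.symm hj.1)] at hc hc'
    linear_combination (hc + hc') / 2
  have hdiag {i j : ι} (hij : i ≠ j) : A i i = A j j := by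
    obtain ⟨c, hc⟩ := heig hij Complex.I_sq
    have hi := hc i
    have hj := hc j
    simp only [hoff hij, hoff hij.symm, Pi.single_eq_same, Pi.single_eq_of_ne hij,
      Pi.single_eq_of_ne hij.symm] at hi hj
    refine mul_left_cancel₀ Complex.I_ne_zero ?_
    linear_combination Complex.I * hi - hj
  obtain ⟨i₀⟩ : Nonempty ι := Fintype.card_pos_iff.1 (by omega)
  refine ⟨A i₀ i₀, Matrix.ext fun i j => ?_⟩
  obtain rfl | hij := eq_or_ne i j
  · obtain rfl | hi := eq_or_ne i i₀
    · simp
    · simp [hdiag hi]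
  · simp [hoff hij, hij]

end Isotropic

theorem eq_re_smul_one_of_map_eq_smul_one {ι : Type*} [DecidableEq ι]
    {A : Matrix ι ι ℝ} {r : ℂ} (h : A.map (algebraMap ℝ ℂ) = r • 1) : A = r.re • 1 := by
  ext i j
  have hij := congrArg Complex.re (congrFun (congrFun h i) j)
  obtain rfl | hne := eq_or_ne i j
  · simpa using hij
  · simpa [hne] using hij

/-! ### The pull-back to the conic -/

theorem exists_eq_absForm_mul_add (H : MvPolynomial (Fin 3) ℝ) :
    ∃ (K : MvPolynomial (Fin 3) ℝ) (A B : MvPolynomial (Fin 2) ℝ),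
      H = absForm * K + rename Fin.succ A + X 0 * rename Fin.succ B := by
  induction H using MvPolynomial.induction_on with
  | C c => exact ⟨0, C c, 0, by simp⟩
  | add p q hp hq =>
    obtain ⟨K, A, B, h⟩ := hp
    obtain ⟨K', A', B', h'⟩ := hq
    refine ⟨K + K', A + A', B + B', ?_⟩
    rw [map_add, map_add]
    linear_combination h + h'
  | mul_X p i hp =>
    obtain ⟨K, A, B, h⟩ := hp
    refine i.cases ?_ fun j => ?_
    · refine ⟨K * X 0 + rename Fin.succ B, -(X 0 ^ 2 + X 1 ^ 2) * B, A, ?_⟩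
      have habs : absForm = X 0 ^ 2 + X 1 ^ 2 + X 2 ^ 2 := Fin.sum_univ_three _
      simp only [map_mul, map_neg, map_add, map_pow, rename_X, h, habs, Fin.succ_zero_eq_one,
        Fin.succ_one_eq_two]
      ring
    · refine ⟨K * X j.succ, A * X j, B * X j, ?_⟩
      simp only [map_mul, rename_X, h]
      ring

theorem eval_map_absForm (w : Fin 3 → ℂ) :
    eval w (map (algebraMap ℝ ℂ) absForm) = w ⬝ᵥ w := by
  simp [absForm, dotProduct, sq]

theorem dotProduct_cons_self (t : ℂ) (u : Fin 2 → ℂ) :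
    (Fin.cons t u : Fin 3 → ℂ) ⬝ᵥ (Fin.cons t u : Fin 3 → ℂ) = t * t + (u 0 ^ 2 + u 1 ^ 2) := by
  simp only [dotProduct, Fin.sum_univ_succ, Fin.cons_zero, Fin.cons_succ, Fin.sum_univ_zero]
  simp only [Fin.succ_zero_eq_one, sq, add_zero]

theorem eval_cons_map_absForm_mul_add (K : MvPolynomial (Fin 3) ℝ) (A B : MvPolynomial (Fin 2) ℝ)
    {t : ℂ} {u : Fin 2 → ℂ} (h : t * t + (u 0 ^ 2 + u 1 ^ 2) = 0) :
    eval (Fin.cons t u : Fin 3 → ℂ) (map (algebraMap ℝ ℂ)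
      (absForm * K + rename Fin.succ A + X 0 * rename Fin.succ B)) =
    eval u (map (algebraMap ℝ ℂ) A) + t * eval u (map (algebraMap ℝ ℂ) B) := by
  have hu : (Fin.cons t u : Fin 3 → ℂ) ∘ Fin.succ = u := rfl
  have habs : eval (Fin.cons t u : Fin 3 → ℂ) (map (algebraMap ℝ ℂ) absForm) = 0 := by
    rw [eval_map_absForm, dotProduct_cons_self, h]
  simp only [map_add, map_mul, map_X, map_rename, eval_X, eval_rename, habs, hu, Fin.cons_zero,
    zero_mul, zero_add]

theorem absForm_dvd_of_forall_isotropic {H : MvPolynomial (Fin 3) ℝ}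
    (h : ∀ w : Fin 3 → ℂ, w ⬝ᵥ w = 0 → eval w (map (algebraMap ℝ ℂ) H) = 0) : absForm ∣ H := by
  obtain ⟨K, A, B, rfl⟩ := exists_eq_absForm_mul_add H
  set A' := map (algebraMap ℝ ℂ) A
  set B' := map (algebraMap ℝ ℂ) B
  -- Above `u` lie the isotropic vectors `(±s, u)` with `s² = -(u₀² + u₁²)`.
  have hvanish (u : Fin 2 → ℂ) : eval u A' = 0 ∧ (u 0 ^ 2 + u 1 ^ 2) * eval u B' = 0 := by
    obtain ⟨s, hs⟩ := IsAlgClosed.exists_eq_mul_self (-(u 0 ^ 2 + u 1 ^ 2))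
    have hiso {t : ℂ} (ht : t * t = s * s) : eval u A' + t * eval u B' = 0 := by
      have ht0 : t * t + (u 0 ^ 2 + u 1 ^ 2) = 0 := by rw [ht, ← hs, neg_add_cancel]
      rw [← eval_cons_map_absForm_mul_add K A B ht0]
      exact h _ ((dotProduct_cons_self t u).trans ht0)
    have hpos := hiso rfl
    have hneg := hiso (neg_mul_neg s s)
    exact ⟨by linear_combination (hpos + hneg) / 2,
      by linear_combination -s * (hpos - hneg) / 2 - eval u B' * hs⟩
  have hinj := map_injective (σ := Fin 2) (algebraMap ℝ ℂ) (algebraMap ℝ ℂ).injective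
  have hA : A = 0 := (map_eq_zero_iff _ hinj).1 (MvPolynomial.funext fun u => by
    rw [(hvanish u).1, map_zero])
  have hq : (X 0 ^ 2 + X 1 ^ 2 : MvPolynomial (Fin 2) ℂ) ≠ 0 := fun h0 => by
    simpa using congrArg (eval ![1, 0]) h0
  have hqB : (X 0 ^ 2 + X 1 ^ 2) * B' = 0 := MvPolynomial.funext fun u => by
    simpa only [map_mul, map_add, map_pow, eval_X, map_zero] using (hvanish u).2
  have hB : B = 0 := (map_eq_zero_iff _ hinj).1 ((mul_eq_zero.1 hqB).resolve_left hq)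
  rw [hA, hB, map_zero, add_zero, mul_zero, add_zero]
  exact dvd_mul_right _ _

theorem eval_pullback (m : Fin 3 → MvPolynomial (Fin 2) ℂ) (H : MvPolynomial (Fin 3) ℝ)
    (v : Fin 2 → ℂ) :
    eval v (pullback m H) = eval (fun i => eval v (m i)) (map (algebraMap ℝ ℂ) H) :=
  eval_aeval m v _

theorem isHomogeneous_pullback {m : Fin 3 → MvPolynomial (Fin 2) ℂ} {k n : ℕ}
    (hm : ∀ i, (m i).IsHomogeneous k) {H : MvPolynomial (Fin 3) ℝ} (hH : H.IsHomogeneous n) :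
    (pullback m H).IsHomogeneous (k * n) :=
  (hH.map (algebraMap ℝ ℂ)).aeval m hm

section ConicParam

variable {μ : P1 → PInf} {m : Fin 3 → MvPolynomial (Fin 2) ℂ}

theorem IsConicParam.eval_zero (hμ : IsConicParam μ m) : (fun i => eval 0 (m i)) = 0 :=
  _root_.funext fun i => by simpa using eval_smul_of_isHomogeneous (hμ.isHomogeneous i) 0 0

theorem IsConicParam.dotProduct_eval (hμ : IsConicParam μ m) (v : Fin 2 → ℂ) :
    (fun i => eval v (m i)) ⬝ᵥ (fun i => eval v (m i)) = 0 := by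
  obtain rfl | hv := eq_or_ne v 0
  · rw [hμ.eval_zero, dotProduct_zero]
  obtain ⟨hne, he⟩ := hμ.map_mk v hv
  have hmem := hμ.bijOn.mapsTo (Set.mem_univ (Projectivization.mk ℂ v hv))
  rwa [he] at hmem

theorem IsConicParam.exists_eval_eq (hμ : IsConicParam μ m) {w : Fin 3 → ℂ} (hw : w ⬝ᵥ w = 0) :
    ∃ v : Fin 2 → ℂ, (fun i => eval v (m i)) = w := by
  obtain rfl | hw0 := eq_or_ne w 0
  · exact ⟨0, hμ.eval_zero⟩
  obtain ⟨p, -, hp⟩ := hμ.bijOn.surjOn (show Projectivization.mk ℂ w hw0 ∈ absConic from hw)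
  induction p using Projectivization.ind with
  | h v hv =>
    obtain ⟨hne, he⟩ := hμ.map_mk v hv
    rw [hp, Projectivization.mk_eq_mk_iff'] at he
    obtain ⟨a, rfl⟩ := he
    obtain ⟨s, rfl⟩ := IsAlgClosed.exists_eq_mul_self a
    refine ⟨s • v, _root_.funext fun i => ?_⟩
    rw [eval_smul_of_isHomogeneous (hμ.isHomogeneous i), Pi.smul_apply, smul_eq_mul, sq]

theorem IsConicParam.pullback_ne_zero (hμ : IsConicParam μ m) {H : MvPolynomial (Fin 3) ℝ}
    (hH : ¬ absForm ∣ H) : pullback m H ≠ 0 := by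
  refine fun h => hH (absForm_dvd_of_forall_isotropic fun w hw => ?_)
  obtain ⟨v, rfl⟩ := hμ.exists_eval_eq hw
  rw [← eval_pullback, h, map_zero]

end ConicParam

/-! ### The Veronese map and symmetric squares -/

section Veronese

variable {R : Type*} [CommRing R]

/-- The degree two Veronese vector, the parametrization of the conic `u₁² = u₀ u₂`. -/
def veronese (v : Fin 2 → R) : Fin 3 → R := ![v 0 ^ 2, v 0 * v 1, v 1 ^ 2]

/-- The Gram matrix of the quadratic form `2 (u₁² - u₀ u₂)`, which vanishes on the Veronese
vectors. -/
def discGram : Matrix (Fin 3) (Fin 3) R := !![0, 0, -1; 0, 2, 0; -1, 0, 0]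

/-- The matrix by which `B` acts on Veronese vectors, its symmetric square. -/
def symSq (B : Matrix (Fin 2) (Fin 2) R) : Matrix (Fin 3) (Fin 3) R :=
  !![B 0 0 ^ 2, 2 * (B 0 0 * B 0 1), B 0 1 ^ 2;
    B 0 0 * B 1 0, B 0 0 * B 1 1 + B 0 1 * B 1 0, B 0 1 * B 1 1;
    B 1 0 ^ 2, 2 * (B 1 0 * B 1 1), B 1 1 ^ 2]

theorem exists_eval_eq_dotProduct_veronese {p : MvPolynomial (Fin 2) R} (hp : p.IsHomogeneous 2) :
    ∃ c : Fin 3 → R, ∀ v, eval v p = c ⬝ᵥ veronese v := by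
  set q : Polynomial R := aeval ![Polynomial.X, 1] p
  refine ⟨![q.coeff 2, q.coeff 1, q.coeff 0], fun v => ?_⟩
  rw [← Polynomial.homogenize_eq_of_isHomogeneous hp rfl, Polynomial.homogenize,
    Finset.Nat.sum_antidiagonal_eq_sum_range_succ_mk]
  simp only [Finset.sum_range_succ, Finset.sum_range_zero, zero_add, map_add, eval_monomial,
    Finsupp.prod_fintype, pow_zero, implies_true, Fin.prod_univ_two]
  simp only [zero_ne_one, ne_eq, not_false_eq_true, Finsupp.single_eq_of_ne, Finsupp.zero_update,
    Finsupp.single_zero, Finsupp.single_eq_same, Finsupp.coe_update, Function.update_of_ne,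
    Function.update_self, pow_zero, pow_one, one_mul, mul_one, Nat.sub_self, Nat.sub_zero,
    Nat.add_one_sub_one, dotProduct, veronese, Fin.sum_univ_three, Matrix.cons_val, q]
  ring

theorem symSq_mulVec_veronese (B : Matrix (Fin 2) (Fin 2) R) (v : Fin 2 → R) :
    (symSq B).mulVec (veronese v) = veronese (B.mulVec v) := by
  ext i
  fin_cases i <;> simp [symSq, veronese, Matrix.mulVec, dotProduct, Fin.sum_univ_succ] <;> ring

theorem symSq_mul (B C : Matrix (Fin 2) (Fin 2) R) : symSq (B * C) = symSq B * symSq C := by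
  ext i j
  fin_cases i <;> fin_cases j <;>
    simp [symSq, Matrix.mul_apply, Fin.sum_univ_succ] <;> ring

theorem symSq_one : symSq (1 : Matrix (Fin 2) (Fin 2) R) = 1 := by
  ext i j
  fin_cases i <;> fin_cases j <;> simp [symSq]

theorem symSq_transpose_mul_discGram_mul (B : Matrix (Fin 2) (Fin 2) R) :
    (symSq B).transpose * discGram * symSq B = B.det ^ 2 • discGram := by
  ext i j
  fin_cases i <;> fin_cases j <;>
    simp [symSq, discGram, Matrix.mul_apply, Fin.sum_univ_succ, Matrix.det_fin_two] <;> ring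

theorem dotProduct_discGram_mulVec (u v : Fin 3 → R) :
    u ⬝ᵥ discGram.mulVec v = 2 * (u 1 * v 1) - u 0 * v 2 - u 2 * v 0 := by
  simp [discGram, Matrix.mulVec, dotProduct, Fin.sum_univ_succ]
  ring

theorem col_dotProduct_mulVec_col {n : Type*} [Fintype n] (S T : Matrix n n R) (i j : n) :
    T.col i ⬝ᵥ S.mulVec (T.col j) = (T.transpose * S * T) i j := by
  rw [Matrix.mul_assoc, Matrix.mul_apply']
  rfl

end Veronese

theorem exists_symSq_eq_of_col_eq_single {K : Type*} [Field K] [NeZero (2 : K)]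
    {T : Matrix (Fin 3) (Fin 3) K} (hT : T.transpose * discGram * T = discGram)
    (h0 : T.col 0 = Pi.single 0 1) (h2 : T.col 2 = Pi.single 2 1) :
    ∃ B : Matrix (Fin 2) (Fin 2) K, B.det ≠ 0 ∧ T = symSq B := by
  have hcol (i j : Fin 3) := col_dotProduct_mulVec_col discGram T i j
  simp only [hT, dotProduct_discGram_mulVec] at hcol
  simp only [Matrix.col_apply] at hcol
  have h0 (i : Fin 3) : T i 0 = (Pi.single 0 1 : Fin 3 → K) i := congrFun h0 i
  have h2 (i : Fin 3) : T i 2 = (Pi.single 2 1 : Fin 3 → K) i := congrFun h2 i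
  have h01 : T 2 1 = 0 := by simpa [h0, discGram] using hcol 0 1
  have h21 : T 0 1 = 0 := by simpa [h2, discGram] using hcol 2 1
  have h11 : T 1 1 ^ 2 = 1 := by
    refine mul_left_cancel₀ (two_ne_zero (α := K)) ?_
    simpa [h01, h21, discGram, sq] using hcol 1 1
  refine ⟨!![1, 0; 0, T 1 1], ?_, ?_⟩
  · rw [Matrix.det_fin_two_of, one_mul, zero_mul, sub_zero]
    exact fun h => by simp [h] at h11
  · ext i j
    fin_cases i <;> fin_cases j <;> simp [symSq, h0, h2, h01, h21, h11]

section AlgClosed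

variable {K : Type*} [Field K] [IsAlgClosed K]

theorem exists_veronese_eq {u : Fin 3 → K} (h : u 1 ^ 2 = u 0 * u 2) :
    ∃ v : Fin 2 → K, veronese v = u := by
  obtain ⟨x, hx⟩ := IsAlgClosed.exists_pow_nat_eq (u 0) two_pos
  obtain rfl | hx0 := eq_or_ne x 0
  · obtain ⟨z, hz⟩ := IsAlgClosed.exists_pow_nat_eq (u 2) two_pos
    have hu0 : u 0 = 0 := by rw [← hx, zero_pow two_ne_zero]
    have hu1 : u 1 = 0 := by simpa [hu0] using h
    refine ⟨![0, z], List.ofFn_injective ?_⟩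
    simp [veronese, hz, hu0, hu1]
  · refine ⟨![x, u 1 / x], List.ofFn_injective ?_⟩
    have hu2 : (u 1 / x) ^ 2 = u 2 := by
      rw [div_pow, h, ← hx, mul_div_cancel_left₀ _ (pow_ne_zero 2 hx0)]
    simp [veronese, hx, hu2, mul_div_cancel₀ _ hx0]

theorem exists_col_eq_veronese [NeZero (2 : K)] {T : Matrix (Fin 3) (Fin 3) K} {a : K}
    (hT : T.transpose * discGram * T = a • discGram) :
    ∃ B : Matrix (Fin 2) (Fin 2) K, B.det ^ 2 = a ∧
      T.col 0 = veronese (B.col 0) ∧ T.col 2 = veronese (B.col 1) := by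
  have hcol (i j : Fin 3) := col_dotProduct_mulVec_col discGram T i j
  simp only [hT, dotProduct_discGram_mulVec] at hcol
  obtain ⟨v, hv⟩ := exists_veronese_eq (u := T.col 0) (mul_left_cancel₀ (two_ne_zero (α := K)) (by
    linear_combination (hcol 0 0).trans (show _ = 0 by simp [discGram])))
  obtain ⟨w, hw⟩ := exists_veronese_eq (u := T.col 2) (mul_left_cancel₀ (two_ne_zero (α := K)) (by
    linear_combination (hcol 2 2).trans (show _ = 0 by simp [discGram])))
  refine ⟨(Matrix.of ![v, w]).transpose, ?_, hv.symm, hw.symm⟩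
  have h02 := hcol 0 2
  rw [← hv, ← hw] at h02
  simp only [veronese, discGram, Matrix.smul_apply, Matrix.of_apply, Matrix.cons_val,
    smul_eq_mul] at h02
  simp only [Matrix.det_fin_two, Matrix.transpose_apply, Matrix.of_apply, Matrix.cons_val]
  linear_combination -h02

theorem exists_symSq_eq [NeZero (2 : K)] {T : Matrix (Fin 3) (Fin 3) K} {a : K} (ha : a ≠ 0)
    (hT : T.transpose * discGram * T = a • discGram) :
    ∃ B : Matrix (Fin 2) (Fin 2) K, B.det ≠ 0 ∧ T = symSq B := by
  obtain ⟨B, rfl, h0, h2⟩ := exists_col_eq_veronese hT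
  have hB := isUnit_iff_ne_zero.2 (ne_zero_pow two_ne_zero ha)
  have hcol {u : Fin 3 → K} {i : Fin 2} (hu : u = veronese (B.col i)) :
      (symSq B⁻¹).mulVec u = veronese (Pi.single i 1) := by
    rw [hu, symSq_mulVec_veronese, ← B.mulVec_single_one, Matrix.mulVec_mulVec,
      B.nonsing_inv_mul hB, Matrix.one_mulVec]
  have hgram : (symSq B⁻¹ * T).transpose * discGram * (symSq B⁻¹ * T) = discGram := calc
    _ = T.transpose * ((symSq B⁻¹).transpose * discGram * symSq B⁻¹) * T := by
      simp only [Matrix.transpose_mul, Matrix.mul_assoc]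
    _ = (B⁻¹ * B).det ^ 2 • discGram := by
      rw [symSq_transpose_mul_discGram_mul, Matrix.mul_smul, Matrix.smul_mul, hT, smul_smul,
        ← mul_pow, Matrix.det_mul]
    _ = discGram := by rw [B.nonsing_inv_mul hB, Matrix.det_one, one_pow, one_smul]
  have hcol0 : (symSq B⁻¹ * T).col 0 = Pi.single 0 1 :=
    (hcol h0).trans (List.ofFn_injective (by simp [veronese]))
  have hcol2 : (symSq B⁻¹ * T).col 2 = Pi.single 2 1 :=
    (hcol h2).trans (List.ofFn_injective (by simp [veronese]))
  obtain ⟨D, hD, hTD⟩ := exists_symSq_eq_of_col_eq_single hgram hcol0 hcol2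
  refine ⟨B * D, Matrix.det_mul B D ▸ mul_ne_zero hB.ne_zero hD, ?_⟩
  rw [symSq_mul, ← hTD, ← Matrix.mul_assoc, ← symSq_mul, B.mul_nonsing_inv hB, symSq_one,
    Matrix.one_mul]

end AlgClosed

theorem eq_smul_discGram_of_forall_veronese {S : Matrix (Fin 3) (Fin 3) ℂ} (hS : S.IsSymm)
    (h : ∀ v, veronese v ⬝ᵥ S.mulVec (veronese v) = 0) : S = (S 1 1 / 2) • discGram := by
  have hquartic (s t : ℂ) : S 0 0 * s ^ 4 + 2 * S 0 1 * s ^ 3 * t +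
      (2 * S 0 2 + S 1 1) * s ^ 2 * t ^ 2 + 2 * S 1 2 * s * t ^ 3 + S 2 2 * t ^ 4 = 0 := by
    have hst := h ![s, t]
    simp only [veronese, Matrix.mulVec, dotProduct, Fin.sum_univ_three, Matrix.cons_val,
      hS.apply 0 1, hS.apply 0 2, hS.apply 1 2] at hst
    linear_combination hst
  have h00 : S 0 0 = 0 := by simpa using hquartic 1 0
  have h22 : S 2 2 = 0 := by simpa using hquartic 0 1
  have h11 := hquartic 1 1
  have hneg := hquartic 1 (-1)
  have htwo := hquartic 1 2
  rw [h00, h22] at h11 hneg htwo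
  have h02 : S 0 2 = -(S 1 1 / 2) := by linear_combination (h11 + hneg) / 4
  have h12 : S 1 2 = 0 := by linear_combination (htwo - (h11 - hneg) - 2 * (h11 + hneg)) / 12
  have h01 : S 0 1 = 0 := by linear_combination (h11 - hneg) / 4 - h12
  ext i j
  fin_cases i <;> fin_cases j <;>
    simp [discGram, h00, h22, h02, h12, h01, hS.apply 0 1, hS.apply 0 2, hS.apply 1 2]

section Lift

variable {μ : P1 → PInf} {m : Fin 3 → MvPolynomial (Fin 2) ℂ}

theorem IsConicParam.isUnit_of_eval_eq_mulVec (hμ : IsConicParam μ m)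
    {N : Matrix (Fin 3) (Fin 3) ℂ} (hN : ∀ v, (fun i => eval v (m i)) = N.mulVec (veronese v)) :
    IsUnit N := by
  refine Matrix.mulVec_surjective_iff_isUnit.1 (LinearMap.range_eq_top (f := N.mulVecLin).1 ?_)
  refine eq_top_iff.2 (span_isotropic_eq_top.symm.trans_le (Submodule.span_le.2 fun w hw => ?_))
  obtain ⟨v, rfl⟩ := hμ.exists_eval_eq hw
  exact ⟨veronese v, (hN v).symm⟩

theorem IsConicParam.exists_transpose_mul_eq (hμ : IsConicParam μ m)
    {N : Matrix (Fin 3) (Fin 3) ℂ} (hN : ∀ v, (fun i => eval v (m i)) = N.mulVec (veronese v)) :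
    ∃ κ : ℂ, κ ≠ 0 ∧ N.transpose * N = κ • discGram := by
  have hvanish (v : Fin 2 → ℂ) :
      veronese v ⬝ᵥ (N.transpose * N).mulVec (veronese v) = 0 := by
    rw [← Matrix.mulVec_mulVec, Matrix.dotProduct_mulVec, Matrix.vecMul_transpose, ← hN]
    exact hμ.dotProduct_eval v
  have hgram := eq_smul_discGram_of_forall_veronese (Matrix.isSymm_transpose_mul_self N) hvanish
  refine ⟨_, fun h0 => ?_, hgram⟩
  have hunit := hμ.isUnit_of_eval_eq_mulVec hN
  have hgram_unit := ((Matrix.isUnit_transpose N).2 hunit).mul hunit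
  rw [hgram, h0, zero_smul] at hgram_unit
  exact not_isUnit_zero hgram_unit

theorem IsConicParam.exists_lift (hμ : IsConicParam μ m) {A : Matrix (Fin 3) (Fin 3) ℂ} {a : ℂ}
    (ha : a ≠ 0) (hA : A.transpose * A = a • 1) : ∃ B : GL (Fin 2) ℂ, ∀ v,
      (fun i => eval (B.val.mulVec v) (m i)) = A.mulVec (fun i => eval v (m i)) := by
  choose c hc using fun i => exists_eval_eq_dotProduct_veronese (hμ.isHomogeneous i)
  set N : Matrix (Fin 3) (Fin 3) ℂ := Matrix.of c
  have hN (v : Fin 2 → ℂ) : (fun i => eval v (m i)) = N.mulVec (veronese v) :=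
    _root_.funext fun i => hc i v
  have hNdet := (Matrix.isUnit_iff_isUnit_det N).1 (hμ.isUnit_of_eval_eq_mulVec hN)
  obtain ⟨κ, hκ, hgram⟩ := hμ.exists_transpose_mul_eq hN
  obtain ⟨T, hNT⟩ : ∃ T, N * T = A * N :=
    ⟨N⁻¹ * (A * N), by rw [← Matrix.mul_assoc, N.mul_nonsing_inv hNdet, Matrix.one_mul]⟩
  have hT : T.transpose * discGram * T = a • discGram := by
    refine smul_right_injective _ hκ ?_
    calc κ • (T.transpose * discGram * T) = (N * T).transpose * (N * T) := by
          rw [← Matrix.smul_mul, ← Matrix.mul_smul, ← hgram, Matrix.transpose_mul]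
          simp only [Matrix.mul_assoc]
      _ = N.transpose * (A.transpose * A) * N := by
          rw [hNT, Matrix.transpose_mul]
          simp only [Matrix.mul_assoc]
      _ = κ • a • discGram := by
          rw [hA, Matrix.mul_smul, Matrix.mul_one, Matrix.smul_mul, hgram, smul_comm]
  obtain ⟨B, hB, hBT⟩ := exists_symSq_eq ha hT
  refine ⟨Matrix.GeneralLinearGroup.mkOfDetNeZero B hB, fun v => ?_⟩
  change (fun i => eval (B.mulVec v) (m i)) = _
  rw [hN, hN, ← symSq_mulVec_veronese, ← hBT, Matrix.mulVec_mulVec, hNT, Matrix.mulVec_mulVec]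

end Lift

/-! ### Zeros of binary forms -/

section BinaryForm

variable {K : Type*} [Field K] {P : MvPolynomial (Fin 2) K} {n : ℕ}

theorem eval_aeval_X_one (P : MvPolynomial (Fin 2) K) (z : K) :
    (aeval ![Polynomial.X, 1] P : Polynomial K).eval z = eval ![z, 1] P := by
  rw [← Polynomial.coe_aeval_eq_eval, ← AlgHom.comp_apply, comp_aeval, ← aeval_eq_eval]
  congr 2
  ext i
  fin_cases i <;> simp

theorem aeval_X_one_ne_zero (hP : P.IsHomogeneous n) (hP0 : P ≠ 0) :
    (aeval ![Polynomial.X, 1] P : Polynomial K) ≠ 0 := fun h => hP0 <| by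
  rw [← Polynomial.homogenize_eq_of_isHomogeneous hP h, Polynomial.homogenize_zero]

theorem smul_div_one_eq {v : Fin 2 → K} (hv : v 1 ≠ 0) : v 1 • ![v 0 / v 1, 1] = v := by
  ext i
  fin_cases i
  · exact mul_div_cancel₀ _ hv
  · exact mul_one _

theorem exists_ne_zero_eval_eq_zero [IsAlgClosed K] (hP : P.IsHomogeneous n) (hn : n ≠ 0) :
    ∃ v : Fin 2 → K, v ≠ 0 ∧ eval v P = 0 := by
  by_cases hdeg : (aeval ![Polynomial.X, 1] P : Polynomial K).degree = 0
  · refine ⟨![1, 0], Function.ne_iff.2 ⟨0, one_ne_zero⟩, ?_⟩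
    rw [← Polynomial.homogenize_eq_of_isHomogeneous hP (Polynomial.eq_C_of_degree_eq_zero hdeg),
      Polynomial.homogenize_C]
    simp [hn]
  · obtain ⟨z, hz⟩ := IsAlgClosed.exists_root _ hdeg
    exact ⟨![z, 1], Function.ne_iff.2 ⟨1, one_ne_zero⟩, (eval_aeval_X_one P z).symm.trans hz⟩

end BinaryForm

section Zeros

variable {P Q : MvPolynomial (Fin 2) ℂ} {n k : ℕ}

theorem mk_mem_zeros_iff (hP : P.IsHomogeneous n) {v : Fin 2 → ℂ} (hv : v ≠ 0) :
    Projectivization.mk ℂ v hv ∈ zeros P ↔ eval v P = 0 := by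
  obtain ⟨a, ha⟩ := Projectivization.exists_smul_eq_mk_rep ℂ v hv
  rw [zeros, Set.mem_ofPred_eq, ← ha, Units.smul_def, eval_smul_of_isHomogeneous hP,
    mul_eq_zero_iff_left (pow_ne_zero n a.ne_zero)]

theorem zeros_finite (hP : P.IsHomogeneous n) (hP0 : P ≠ 0) : (zeros P).Finite := by
  have hz (z : ℂ) : ![z, 1] ≠ 0 := Function.ne_iff.2 ⟨1, one_ne_zero⟩
  have hinfty : ![(1 : ℂ), 0] ≠ 0 := Function.ne_iff.2 ⟨0, one_ne_zero⟩
  refine (((Polynomial.finite_setOfPred_isRoot (aeval_X_one_ne_zero hP hP0)).image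
    fun z => Projectivization.mk ℂ ![z, 1] (hz z)).insert
      (Projectivization.mk ℂ ![1, 0] hinfty)).subset fun q hq => ?_
  induction q using Projectivization.ind with
  | h v hv =>
    rw [mk_mem_zeros_iff hP hv] at hq
    obtain hv1 | hv1 := eq_or_ne (v 1) 0
    · refine Or.inl ((Projectivization.mk_eq_mk_iff' ..).2 ⟨v 0, List.ofFn_injective ?_⟩)
      simp [hv1]
    · refine Or.inr ⟨v 0 / v 1, ?_, ((Projectivization.mk_eq_mk_iff' ..).2
        ⟨v 1, smul_div_one_eq hv1⟩).symm⟩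
      rw [← smul_div_one_eq hv1, eval_smul_of_isHomogeneous hP] at hq
      exact (eval_aeval_X_one P _).trans ((mul_eq_zero.1 hq).resolve_left (pow_ne_zero n hv1))

theorem eval_comp (P : MvPolynomial (Fin 2) ℂ) (B : GL (Fin 2) ℂ) (v : Fin 2 → ℂ) :
    eval v (comp P B) = eval (B • v) P := by
  rw [comp_eq_linSubst, eval_linSubst]
  rfl

theorem smul_mem_zeros_iff (hP : P.IsHomogeneous n) (hQ : Q.IsHomogeneous k)
    {φ : PGL(Fin 2, ℂ)} (hφ : φ ∈ autForms P Q) (p : P1) : φ • p ∈ zeros Q ↔ p ∈ zeros P := by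
  obtain ⟨B, rfl, c, hc, hcomp⟩ := hφ
  induction p using Projectivization.ind with
  | h v hv =>
    rw [Projectivization.PGL.mk_smul_mk, mk_mem_zeros_iff hQ, mk_mem_zeros_iff hP, ← eval_comp,
      hcomp, smul_eval, mul_eq_zero_iff_left hc]

theorem image_smul_zeros (hP : P.IsHomogeneous n) (hQ : Q.IsHomogeneous k) {φ : PGL(Fin 2, ℂ)}
    (hφ : φ ∈ autForms P Q) : (fun p : P1 => φ • p) '' zeros P = zeros Q := by
  refine Set.Subset.antisymm (Set.image_subset_iff.2 fun p => (smul_mem_zeros_iff hP hQ hφ p).2)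
    fun q hq => ⟨φ⁻¹ • q, ?_, smul_inv_smul φ q⟩
  rwa [← smul_mem_zeros_iff hP hQ hφ, smul_inv_smul]

end Zeros

section Conjugation

theorem eval_star_map_algebraMap {σ : Type*} (H : MvPolynomial σ ℝ) (w : σ → ℂ) :
    eval (star w) (map (algebraMap ℝ ℂ) H) = star (eval w (map (algebraMap ℝ ℂ) H)) := by
  simp only [eval_map, ← aeval_def]
  exact (comp_aeval_apply (φ := Complex.conjAe.toAlgHom) w H).symm

theorem star_ne_smul_of_isotropic {ι : Type*} [Fintype ι] {w : ι → ℂ} (hw : w ≠ 0)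
    (hiso : w ⬝ᵥ w = 0) (c : ℂ) : star w ≠ c • w := fun h => hw <| by
  open scoped ComplexOrder in
  rw [← dotProduct_star_self_eq_zero, h, smul_dotProduct, hiso, smul_zero]

theorem two_le_ncard_zeros {μ : P1 → PInf} {m : Fin 3 → MvPolynomial (Fin 2) ℂ}
    (hμ : IsConicParam μ m) {H : MvPolynomial (Fin 3) ℝ} {n : ℕ} (hn : n ≠ 0)
    (hH : H.IsHomogeneous n) (hfin : (zeros (pullback m H)).Finite) :
    2 ≤ (zeros (pullback m H)).ncard := by
  have hP := isHomogeneous_pullback hμ.isHomogeneous hH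
  obtain ⟨v, hv, hPv⟩ := exists_ne_zero_eval_eq_zero hP (mul_ne_zero two_ne_zero hn)
  obtain ⟨hw, -⟩ := hμ.map_mk v hv
  obtain ⟨v', hv'⟩ := hμ.exists_eval_eq (w := star fun i => eval v (m i)) (by
    rw [Matrix.star_dotProduct_star, hμ.dotProduct_eval, star_zero])
  have hv'0 : v' ≠ 0 := by
    rintro rfl
    exact hw (star_eq_zero.1 (hv'.symm.trans hμ.eval_zero))
  have hPv' : eval v' (pullback m H) = 0 := by
    rw [eval_pullback, hv', eval_star_map_algebraMap, ← eval_pullback, hPv, star_zero]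
  refine (Set.one_lt_ncard_iff hfin).2 ⟨_, _, (mk_mem_zeros_iff hP hv).2 hPv,
    (mk_mem_zeros_iff hP hv'0).2 hPv', fun heq => ?_⟩
  obtain ⟨a, rfl⟩ := (Projectivization.mk_eq_mk_iff' ..).1 heq.symm
  refine star_ne_smul_of_isotropic hw (hμ.dotProduct_eval v) (a ^ 2) (hv'.symm.trans ?_)
  exact _root_.funext fun i => eval_smul_of_isHomogeneous (hμ.isHomogeneous i) a v

end Conjugation

/-! ### Automorphisms of the projective line -/

section ThreePoints

variable {K : Type*} [Field K]

theorem exists_eq_smul_of_three_eigenvectors {V : Type*} [AddCommGroup V] [Module K V]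
    (hV : Module.finrank K V = 2) {f : Module.End K V} {u v w : V}
    (huv : LinearIndependent K ![u, v]) (huw : LinearIndependent K ![u, w])
    (hvw : LinearIndependent K ![v, w]) (hu : ∃ a : K, f u = a • u) (hv : ∃ b : K, f v = b • v)
    (hw : ∃ c : K, f w = c • w) : ∃ a : K, f = a • 1 := by
  obtain ⟨a, hu⟩ := hu
  obtain ⟨b, hv⟩ := hv
  obtain ⟨c, hw⟩ := hw
  have hspan (z : V) : ∃ x y : K, x • u + y • v = z := by
    have htop := huv.span_eq_top_of_card_eq_finrank (by rw [hV, Fintype.card_fin])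
    rw [Matrix.range_cons_cons_empty, Submodule.eq_top_iff'] at htop
    exact Submodule.mem_span_pair.1 (htop z)
  obtain ⟨x, y, rfl⟩ := hspan w
  have hx : x ≠ 0 := by
    rintro rfl
    exact one_ne_zero (neg_eq_zero.1 (LinearIndependent.pair_iff.1 hvw y (-1) (by module)).2)
  have hy : y ≠ 0 := by
    rintro rfl
    exact one_ne_zero (neg_eq_zero.1 (LinearIndependent.pair_iff.1 huw x (-1) (by module)).2)
  have hdep : (x * (a - c)) • u + (y * (b - c)) • v = 0 := by
    rw [map_add, map_smul, map_smul, hu, hv] at hw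
    linear_combination (norm := module) hw
  obtain ⟨hac, hbc⟩ := LinearIndependent.pair_iff.1 huv _ _ hdep
  obtain rfl := sub_eq_zero.1 ((mul_eq_zero.1 hac).resolve_left hx)
  obtain rfl := sub_eq_zero.1 ((mul_eq_zero.1 hbc).resolve_left hy)
  refine ⟨b, LinearMap.ext fun z => ?_⟩
  obtain ⟨s, t, rfl⟩ := hspan z
  rw [map_add, map_smul, map_smul, hu, hv, LinearMap.smul_apply, Module.End.one_apply]
  module

theorem mk_eq_one_of_eq_smul_one {ι : Type*} [Fintype ι] [DecidableEq ι] [Nonempty ι]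
    {g : GL ι K} {a : K} (hg : (g : Matrix ι ι K) = a • 1) : Matrix.ProjGenLinGroup.mk g = 1 := by
  have ha : a ≠ 0 := by
    rintro rfl
    exact g.ne_zero (hg.trans (zero_smul K 1))
  rw [← Matrix.ProjGenLinGroup.mk_scalar (Units.mk0 a ha)]
  exact congrArg _ (Units.ext (hg.trans (Matrix.smul_one_eq_diagonal a)))

theorem eq_one_of_fixes_three {φ : PGL(Fin 2, K)} {p q r : ℙ K (Fin 2 → K)} (hpq : p ≠ q)
    (hpr : p ≠ r) (hqr : q ≠ r) (hp : φ • p = p) (hq : φ • q = q) (hr : φ • r = r) : φ = 1 := by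
  induction φ using Matrix.ProjGenLinGroup.induction_on with | mk g =>
  induction p using Projectivization.ind with | h u hu =>
  induction q using Projectivization.ind with | h v hv =>
  induction r using Projectivization.ind with | h w hw =>
  have heig {z : Fin 2 → K} {hz : z ≠ 0} (h : Matrix.ProjGenLinGroup.mk g •
      Projectivization.mk K z hz = Projectivization.mk K z hz) :
      ∃ a : K, Matrix.toLin' (g : Matrix (Fin 2) (Fin 2) K) z = a • z := by
    obtain ⟨a, ha⟩ := (Projectivization.mk_eq_mk_iff' ..).1 h
    exact ⟨a, ha.symm⟩
  rw [← Projectivization.independent_pair_iff_ne,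
    Projectivization.independent_mk_iff_LinearIndependent] at hpq hpr hqr
  obtain ⟨a, ha⟩ := exists_eq_smul_of_three_eigenvectors (by simp) hpq hpr hqr
    (heig hp) (heig hq) (heig hr)
  refine mk_eq_one_of_eq_smul_one (a := a) (Matrix.toLin'.injective ?_)
  rw [ha, map_smul, Matrix.toLin'_one]
  rfl

end ThreePoints

theorem autForms_finite {P Q : MvPolynomial (Fin 2) ℂ} {n k : ℕ} (hP : P.IsHomogeneous n)
    (hQ : Q.IsHomogeneous k) (hPfin : (zeros P).Finite) (hQfin : (zeros Q).Finite)
    (h3 : 3 ≤ (zeros P).ncard) : (autForms P Q).Finite := by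
  have := hPfin.to_subtype
  have := hQfin.to_subtype
  obtain ⟨p, q, r, hp, hq, hr, hpq, hpr, hqr⟩ := (Set.two_lt_ncard_iff hPfin).1 h3
  let restrict (φ : autForms P Q) (x : zeros P) : zeros Q :=
    ⟨φ.1 • x.1, (smul_mem_zeros_iff hP hQ φ.2 x).2 x.2⟩
  refine Set.finite_coe_iff.1 (Finite.of_injective restrict fun φ ψ h => Subtype.ext ?_)
  have hfix {x : P1} (hx : x ∈ zeros P) : (ψ.1⁻¹ * φ.1) • x = x := by
    have hφψ : φ.1 • x = ψ.1 • x := congrArg Subtype.val (congrFun h ⟨x, hx⟩)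
    rw [mul_smul, hφψ, inv_smul_smul]
  exact (inv_mul_eq_one.1 (eq_one_of_fixes_three hpq hpr hqr (hfix hp) (hfix hq) (hfix hr))).symm

/-! ### Similarities acting on the absolute conic -/

theorem map_transpose_mul_map {n : Type*} [Fintype n] [DecidableEq n] {R S : Type*} [CommRing R]
    [CommRing S] (f : R →+* S) {A : Matrix n n R} {a : R} (h : A.transpose * A = a • 1) :
    (A.map f).transpose * A.map f = f a • 1 := by
  rw [← Matrix.transpose_map, ← Matrix.map_mul, h, Matrix.smul_one_eq_diagonal,
    Matrix.smul_one_eq_diagonal, Matrix.diagonal_map (map_zero f)]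

theorem IsConicParam.apply_mk_smul {μ : P1 → PInf} {m : Fin 3 → MvPolynomial (Fin 2) ℂ}
    (hμ : IsConicParam μ m) {A : GL (Fin 3) ℂ} {B : GL (Fin 2) ℂ}
    (hB : ∀ v, (fun i => eval (B.val.mulVec v) (m i)) = A.val.mulVec (fun i => eval v (m i)))
    (p : P1) : μ (Matrix.ProjGenLinGroup.mk B • p) = A • μ p := by
  induction p using Projectivization.ind with
  | h v hv =>
    obtain ⟨_, hμv⟩ := hμ.map_mk v hv
    obtain ⟨_, hμBv⟩ := hμ.map_mk (B • v) ((smul_ne_zero_iff_ne B).2 hv)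
    rw [Projectivization.PGL.mk_smul_mk, hμBv, hμv, Projectivization.smul_mk]
    exact (Projectivization.mk_eq_mk_iff' ..).2 ⟨1, by rw [one_smul]; exact (hB v).symm⟩

theorem comp_pullback_eq_smul {m : Fin 3 → MvPolynomial (Fin 2) ℂ} {Ft Gt : MvPolynomial (Fin 3) ℝ}
    {A : Matrix (Fin 3) (Fin 3) ℝ} {c : ℝ} (hc : linSubst A Gt = C c * Ft) {B : GL (Fin 2) ℂ}
    (hB : ∀ v, (fun i => eval (B.val.mulVec v) (m i)) =
      (A.map (algebraMap ℝ ℂ)).mulVec (fun i => eval v (m i))) :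
    comp (pullback m Gt) B = (c : ℂ) • pullback m Ft := MvPolynomial.funext fun v => by
  rw [comp_eq_linSubst, eval_linSubst, smul_eval, eval_pullback, eval_pullback, hB,
    ← eval_linSubst, ← map_linSubst, hc, map_mul, map_C, map_mul, eval_C]
  rfl

section Similarity

variable {d : ℕ} {F G : MvPolynomial (Fin 4) ℝ} {Ft Gt : MvPolynomial (Fin 3) ℝ}
  {μ : P1 → PInf} {m : Fin 3 → MvPolynomial (Fin 2) ℂ} {ψ ψ' : E3 ≃ᵃ[ℝ] E3}

theorem IsReducedInfinityPart.ne_zero (hF : IsReducedInfinityPart F Ft) : F ≠ 0 := by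
  rintro rfl
  obtain ⟨⟨k, hk⟩, hnd⟩ := hF
  refine hnd ?_
  rw [atInfinity, map_zero, eq_comm, mul_eq_zero] at hk
  rw [hk.resolve_left (pow_ne_zero k absForm_ne_zero)]
  exact dvd_zero _

theorem exists_mem_autForms (hF : F.IsHomogeneous d) (hG : G.IsHomogeneous d)
    (hirr : Irreducible F) (hdim : realDim (realLocus F) = 2) (hFt : IsReducedInfinityPart F Ft)
    (hGt : IsReducedInfinityPart G Gt) (hμ : IsConicParam μ m)
    (hψ : ψ ∈ simSet (realLocus F) (realLocus G)) :
    ∃ φ ∈ autForms (pullback m Ft) (pullback m Gt), ∀ p, μ (φ • p) = actInf ψ (μ p) := by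
  obtain ⟨hsim, himg⟩ := hψ
  obtain ⟨c, hc, hcF⟩ := exists_linSubst_affMatrix_eq hF hirr hdim hG hGt.ne_zero
    (Set.image_subset_iff.1 himg.subset)
  have hinf : linSubst (linMatrix ψ).val (atInfinity G) = C c * atInfinity F := by
    rw [linSubst_atInfinity _ (ψ 0), hcF, atInfinity_C_mul]
  obtain ⟨c', hc', hcFt⟩ := hFt.exists_linSubst_eq hGt hsim hc hinf
  obtain ⟨⟨a, ha, hA⟩, -⟩ := hsim
  obtain ⟨B, hB⟩ := hμ.exists_lift (Complex.ofReal_ne_zero.2 ha.ne')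
    (map_transpose_mul_map (algebraMap ℝ ℂ) hA)
  exact ⟨_, ⟨B, rfl, c', Complex.ofReal_ne_zero.2 hc', comp_pullback_eq_smul hcFt hB⟩,
    hμ.apply_mk_smul (A := Matrix.GeneralLinearGroup.map (algebraMap ℝ ℂ) (linMatrix ψ)) hB⟩

theorem exists_linMatrix_eq_smul_one (hψ : ψ ∈ Sim) (h : ∀ q ∈ absConic, actInf ψ q = q) :
    ∃ r : ℝ, 0 < r ∧ (linMatrix ψ).val = r • 1 := by
  have heig (w : Fin 3 → ℂ) (hiso : w ⬝ᵥ w = 0) :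
      ∃ c : ℂ, ((linMatrix ψ).val.map (algebraMap ℝ ℂ)).mulVec w = c • w := by
    obtain rfl | hw := eq_or_ne w 0
    · exact ⟨0, by rw [Matrix.mulVec_zero, smul_zero]⟩
    · obtain ⟨c, hc⟩ := (Projectivization.mk_eq_mk_iff' ..).1 (h (Projectivization.mk ℂ w hw) hiso)
      exact ⟨c, hc.symm⟩
  obtain ⟨r, hr⟩ := exists_eq_smul_one_of_isotropic_eigenvectors (by simp) heig
  have hre := eq_re_smul_one_of_map_eq_smul_one hr
  refine ⟨r.re, ?_, hre⟩
  have hdet : 0 < (linMatrix ψ).val.det := hψ.2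
  rw [hre, Matrix.det_smul, Matrix.det_one, mul_one, Fintype.card_fin] at hdet
  exact (Odd.pow_pos_iff (by decide)).1 hdet

theorem eq_of_actInf_eq {S : Set E3} (hcyl : ¬ IsCylinder (realLocus F))
    (hcone : ¬ IsCone (realLocus F)) (hψ : ψ ∈ simSet (realLocus F) S)
    (hψ' : ψ' ∈ simSet (realLocus F) S) (h : ∀ q ∈ absConic, actInf ψ q = actInf ψ' q) :
    ψ = ψ' := by
  have hmaps : Set.MapsTo (ψ'⁻¹ * ψ) (realLocus F) (realLocus F) := fun x hx => by
    obtain ⟨y, hy, hyx⟩ : ψ x ∈ ψ' '' realLocus F := by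
      rw [hψ'.2, ← hψ.2]
      exact Set.mem_image_of_mem ψ hx
    rwa [show (ψ'⁻¹ * ψ) x = y from ψ'.symm_apply_eq.2 hyx.symm]
  have hfix (q : PInf) (hq : q ∈ absConic) : actInf (ψ'⁻¹ * ψ) q = q := by
    have hq' := h q hq
    rw [actInf, actInf] at hq'
    rw [actInf, map_mul, map_inv, map_mul, map_inv, mul_smul, hq', inv_smul_smul]
  obtain ⟨r, hr, hlin⟩ :=
    exists_linMatrix_eq_smul_one (Sim.mul_mem (Sim.inv_mem hψ'.1) hψ.1) hfix
  refine (inv_mul_eq_one.1 (eq_one_of_mapsTo_of_apply_eq_smul_add hcyl hcone hmaps hr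
    fun x => ?_)).symm
  rw [apply_eq_mulVec_add (ψ'⁻¹ * ψ) x, hlin, Matrix.smul_mulVec, Matrix.one_mulVec]

end Similarity

end SurfaceSim

open SurfaceSim in
theorem mainTheorem4_general {d : ℕ} {F G : MvPolynomial (Fin 4) ℝ}
    (hF : F.IsHomogeneous d) (hG : G.IsHomogeneous d) (hirr : Irreducible F)
    (hdim : realDim (realLocus F) = 2) (hcyl : ¬ IsCylinder (realLocus F))
    (hcone : ¬ IsCone (realLocus F)) {Ft Gt : MvPolynomial (Fin 3) ℝ}
    (hFt : IsReducedInfinityPart F Ft) (hGt : IsReducedInfinityPart G Gt)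
    (hFt0 : 0 < Ft.totalDegree) (hGt0 : 0 < Gt.totalDegree)
    {μ : P1 → PInf} {m : Fin 3 → MvPolynomial (Fin 2) ℂ} (hμ : IsConicParam μ m) :
    (∃ ι : simSet (realLocus F) (realLocus G) → autForms (pullback m Ft) (pullback m Gt),
      (∀ (ψ : simSet (realLocus F) (realLocus G)) (p : P1),
        μ ((ι ψ : PGL(Fin 2, ℂ)) • p) = actInf (ψ : E3 ≃ᵃ[ℝ] E3) (μ p)) ∧
      Function.Injective ι) ∧
    ((zeros (pullback m Ft)).Finite ∧ 2 ≤ (zeros (pullback m Ft)).ncard ∧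
      (zeros (pullback m Gt)).Finite ∧ 2 ≤ (zeros (pullback m Gt)).ncard ∧
      ∀ φ ∈ autForms (pullback m Ft) (pullback m Gt),
        (fun p : P1 => φ • p) '' zeros (pullback m Ft) = zeros (pullback m Gt)) ∧
    (3 ≤ (zeros (pullback m Ft)).ncard →
      (simSet (realLocus F) (realLocus G)).Finite ∧
        (autForms (pullback m Ft) (pullback m Gt)).Finite) := by
  obtain ⟨n, hFth⟩ := hFt.exists_isHomogeneous hF
  obtain ⟨k, hGth⟩ := hGt.exists_isHomogeneous hG
  have hP := isHomogeneous_pullback hμ.isHomogeneous hFth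
  have hQ := isHomogeneous_pullback hμ.isHomogeneous hGth
  have hPfin := zeros_finite hP (hμ.pullback_ne_zero hFt.2)
  have hQfin := zeros_finite hQ (hμ.pullback_ne_zero hGt.2)
  have hP2 := two_le_ncard_zeros hμ (hFt0.trans_le hFth.totalDegree_le).ne' hFth hPfin
  have hQ2 := two_le_ncard_zeros hμ (hGt0.trans_le hGth.totalDegree_le).ne' hGth hQfin
  choose ι hι hιμ using fun ψ : simSet (realLocus F) (realLocus G) =>
    exists_mem_autForms hF hG hirr hdim hFt hGt hμ ψ.2
  have hinj : Function.Injective fun ψ =>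
      (⟨ι ψ, hι ψ⟩ : autForms (pullback m Ft) (pullback m Gt)) := fun ψ ψ' h => by
    refine Subtype.ext (eq_of_actInf_eq hcyl hcone ψ.2 ψ'.2 fun q hq => ?_)
    obtain ⟨p, -, rfl⟩ := hμ.bijOn.surjOn hq
    rw [← hιμ, ← hιμ, show ι ψ = ι ψ' from congrArg Subtype.val h]
  refine ⟨⟨_, hιμ, hinj⟩, ⟨hPfin, hP2, hQfin, hQ2, fun φ hφ => image_smul_zeros hP hQ hφ⟩,
    fun h3 => ?_⟩
  have hfin := autForms_finite hP hQ hPfin hQfin h3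
  have := hfin.to_subtype
  exact ⟨Set.finite_coe_iff.1 (Finite.of_injective _ hinj), hfin⟩

theorem mainTheorem4
    (d : ℕ) (F G : MvPolynomial (Fin 4) ℝ)
    (hF : SurfaceSim.IsSurfaceForm d F) (hG : SurfaceSim.IsSurfaceForm d G)
    (R S : Set SurfaceSim.E3)
    (hR : R = SurfaceSim.realLocus F) (hS : S = SurfaceSim.realLocus G)
    (hRcyl : ¬ SurfaceSim.IsCylinder R) (hScyl : ¬ SurfaceSim.IsCylinder S)
    (hRcone : ¬ SurfaceSim.IsCone R) (hScone : ¬ SurfaceSim.IsCone S)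
    (hRrev : ¬ SurfaceSim.IsRevolution R) (hSrev : ¬ SurfaceSim.IsRevolution S)
    (Ft Gt : MvPolynomial (Fin 3) ℝ)
    (hFt : SurfaceSim.IsReducedInfinityPart F Ft) (hGt : SurfaceSim.IsReducedInfinityPart G Gt)
    (hFt0 : 0 < Ft.totalDegree) (hGt0 : 0 < Gt.totalDegree)
    (μ : SurfaceSim.P1 → SurfaceSim.PInf) (m : Fin 3 → MvPolynomial (Fin 2) ℂ)
    (hμ : SurfaceSim.IsConicParam μ m)
    (P Q : MvPolynomial (Fin 2) ℂ)
    (hP : P = SurfaceSim.pullback m Ft) (hQ : Q = SurfaceSim.pullback m Gt) :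
    (∃ ι : SurfaceSim.simSet R S → SurfaceSim.autForms P Q,
      (∀ (ψ : SurfaceSim.simSet R S) (p : SurfaceSim.P1),
        μ ((ι ψ : PGL(Fin 2, ℂ)) • p) = SurfaceSim.actInf (ψ : SurfaceSim.E3 ≃ᵃ[ℝ] SurfaceSim.E3) (μ p)) ∧
      Function.Injective ι) ∧
    ((SurfaceSim.zeros P).Finite ∧ 2 ≤ (SurfaceSim.zeros P).ncard ∧
      (SurfaceSim.zeros Q).Finite ∧ 2 ≤ (SurfaceSim.zeros Q).ncard ∧
      ∀ φ ∈ SurfaceSim.autForms P Q,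
        (fun p : SurfaceSim.P1 => φ • p) '' SurfaceSim.zeros P = SurfaceSim.zeros Q) ∧
    (3 ≤ (SurfaceSim.zeros P).ncard →
      (SurfaceSim.simSet R S).Finite ∧ (SurfaceSim.autForms P Q).Finite) := by
  subst hR hS hP hQ
  exact mainTheorem4_general hF.isHomogeneous hG.isHomogeneous
    (SurfaceSim.irreducible_of_irreducible_map _ hF.irreducible) hF.dim hRcyl hRcone hFt hGt
    hFt0 hGt0 hμ
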